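/- Let $d\in\mathbb N$, let $a<b$ be real numbers, let $P_1,P_0\in\mathbb R^{d\times d}$ with $P_1=P_1^*$ invertible and $P_0=-P_0^*$, and let $\mathcal H:(a,b)\to\mathbb R^{d\times d}$ be measurable such that for some constants $m_0,m_1>0$ we have $m_0\le\mathcal H(x)=\mathcal H(x)^*\le m_1$ (in the sense of positive definiteness) for all $x\in(a,b)$. Let $H$ be the real Hilbert space $L_2(a,b)^d$ with the inner product $\langle u,v\rangle_H:=\langle\mathcal Hu,v\rangle_{L_2(a,b)^d}$. Let $\mathcal A:\operatorname{dom}(\mathcal A)\subseteq H\to H$ be the linear operator $$\mathcal Au=P_1(\mathcal Hu)'+P_0\mathcal Hu$$ (with the weak derivative), whose domain is a linear subspace of $H$ with $$\{u\in H:\mathcal Hu\in H^1_0(a,b)^d\}\subseteq\operatorname{dom}(\mathcal A)\subseteq\{u\in H:\mathcal Hu\in H^1(a,b)^d\}.$$ For $\mathcal Hu\in H^1(a,b)^d$ the boundary values $(\mathcal Hu)(a)$, $(\mathcal Hu)(b)$ are those of the representative that is continuous on $[a,b]$. The operator $\mathcal A$ is called accretive if $\langle\mathcal Au,u\rangle_H\ge0$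 for all $u\in\operatorname{dom}(\mathcal A)$, and m-accretive if moreover $1+\mathcal A$ maps $\operatorname{dom}(\mathcal A)$ onto $H$. Let $E_+$ and $E_-$ be the linear spans of the eigenvectors of $P_1$ for positive and for negative eigenvalues, respectively, let $\iota_\pm:E_\pm\to\mathbb R^d$ be the inclusions, and put $Q_\pm:=\iota_\pm\,(\pm\,\iota_\pm^*P_1\iota_\pm)^{1/2}\,\iota_\pm^*\in\mathbb R^{d\times d}$. For matrices, $\|\cdot\|$ is the operator norm for the Euclidean norm on $\mathbb R^d$. For $W\in\mathbb R^{d\times2d}$ put $$D_W:=\left\{u\in H:\ \mathcal Hu\in H^1(a,b)^d,\ W\begin{pmatrix}(\mathcal Hu)(b)\\(\mathcal Hu)(a)\end{pmatrix}=0\right\}.$$ **Theorem 2.4.** The following statements are equivalent: (i) $\mathcal A$ is m-accretive; (ii) $\mathcal A$ is accretive and there exists $W\in\mathbb R^{d\times2d}$ with $\operatorname{dom}(\mathcal A)=D_W$; (iii) there exists $W\in\mathbb R^{d\times2d}$ of rank $d$ with $\operatorname{dom}(\mathcal A)=D_W$ and $$W\begin{pmatrix}-P_1&P_1\\1&1\end{pmatrix}^{-1}\begin{pmatrix}0&1\\1&0\end{pmatrix}\left(W\begin{pmatrix}-P_1&P_1\\1&1\end{pmatrix}^{-1}\right)^*\ge0;$$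 (iv) there exists $M\in\mathbb R^{d\times d}$ with $\|M\|\le1$ and $$\operatorname{dom}(\mathcal A)=\left\{u\in H:\ \mathcal Hu\in H^1(a,b)^d,\ Q_+(\mathcal Hu)(a)+Q_-(\mathcal Hu)(b)=M\bigl(Q_+(\mathcal Hu)(b)+Q_-(\mathcal Hu)(a)\bigr)\right\}.$$ Moreover, for every $M$ as in (iv) and every $u\in\operatorname{dom}(\mathcal A)$, $$\langle\mathcal Au,u\rangle_H=\tfrac12\left(\|y\|^2-\|My\|^2\right),\qquad y:=Q_+(\mathcal Hu)(b)+Q_-(\mathcal Hu)(a).$$ Furthermore, for every $M$ as in (iv) and every $W$ as in (ii) or as in (iii) there is an invertible $K\in\mathbb R^{d\times d}$ with $$W=K\begin{pmatrix}Q_--MQ_+&Q_+-MQ_-\end{pmatrix}.$$ -/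

import Mathlib

open MeasureTheory Set
open scoped ContDiff InnerProductSpace

noncomputable section

namespace PortHamiltonian

/-! ### Accretive operators

The Hilbert spaces below carry a non-standard inner product, which is why the inner product is an
explicit argument `ip` of the next two definitions. -/

/-- `A` is accretive with respect to the (real) inner product `ip`. -/
def IsAccretive {V : Type*} [AddCommGroup V] [Module ℝ V] (ip : V → V → ℝ) (A : V →ₗ.[ℝ] V) :
    Prop :=
  ∀ u : A.domain, 0 ≤ ip (A u) (u : V)

/-- `A` is m-accretive: accretive, and `1 + A` maps the domain of `A` onto the whole space. -/
def IsMAccretive {V : Type*} [AddCommGroup V] [Module ℝ V] (ip : V → V → ℝ) (A : V →ₗ.[ℝ] V) :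
    Prop :=
  IsAccretive ip A ∧ ∀ f : V, ∃ u : A.domain, (u : V) + A u = f

/-! ### Sobolev spaces on a bounded interval -/

/-- `ℝ^d` with its Euclidean norm. -/
abbrev Euc (d : ℕ) : Type := EuclideanSpace ℝ (Fin d)

/-- The linear map on `ℝ^d` given by a matrix. -/
abbrev act {d : ℕ} (A : Matrix (Fin d) (Fin d) ℝ) : Euc d →L[ℝ] Euc d :=
  Matrix.toEuclideanCLM (n := Fin d) (𝕜 := ℝ) A

/-- Lebesgue measure on the interval `(a, b)`. -/
abbrev vol (a b : ℝ) : Measure ℝ := volume.restrict (Ioo a b)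

/-- The space `L₂(a, b)^d`. -/
abbrev L2 (d : ℕ) (a b : ℝ) : Type := Lp (Euc d) 2 (vol a b)

/-- `f` lies in `H¹(a, b)^d` with weak derivative `g`: both are square integrable, and the
integration by parts formula holds for all test functions on `(a, b)`. -/
structure HasH1Deriv {d : ℕ} (a b : ℝ) (f g : ℝ → Euc d) : Prop where
  memLp : MemLp f 2 (vol a b)
  memLp_deriv : MemLp g 2 (vol a b)
  integral_eq : ∀ φ : ℝ → ℝ, ContDiff ℝ ∞ φ → HasCompactSupport φ → tsupport φ ⊆ Ioo a b →
    ∫ x in Ioo a b, deriv φ x • f x = -∫ x in Ioo a b, φ x • g x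

/-- The Sobolev space `H¹(a, b)^d`. -/
def MemH1 {d : ℕ} (a b : ℝ) (f : ℝ → Euc d) : Prop := ∃ g, HasH1Deriv a b f g

/-- The Sobolev space `H¹₀(a, b)^d`: the closure in `H¹(a, b)^d` of the smooth functions with
compact support in `(a, b)`. -/
def MemH10 {d : ℕ} (a b : ℝ) (f : ℝ → Euc d) : Prop :=
  ∃ g, HasH1Deriv a b f g ∧ ∀ ε : ENNReal, 0 < ε → ∃ φ : ℝ → Euc d,
    ContDiff ℝ ∞ φ ∧ HasCompactSupport φ ∧ tsupport φ ⊆ Ioo a b ∧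
      eLpNorm (f - φ) 2 (vol a b) < ε ∧ eLpNorm (g - deriv φ) 2 (vol a b) < ε

open Classical in
/-- The representative of `f` which is continuous on `[a, b]`. Every `f` in `H¹(a, b)^d` has one
(for other functions it may fail to exist, and the value is then `0`). For `a < b` its values on
`[a, b]`, in particular those at the endpoints, are uniquely determined. -/
def contRep {d : ℕ} (a b : ℝ) (f : ℝ → Euc d) : ℝ → Euc d :=
  if h : ∃ v : ℝ → Euc d, ContinuousOn v (Icc a b) ∧ v =ᵐ[vol a b] f then h.choose else 0

/-- The weak derivative is unique almost everywhere. -/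
theorem HasH1Deriv.ae_eq {d : ℕ} {a b : ℝ} {f f' g g' : ℝ → Euc d} (h : HasH1Deriv a b f g)
    (h' : HasH1Deriv a b f' g') (hff : f =ᵐ[vol a b] f') : g =ᵐ[vol a b] g' := by
  have hi : ∀ {k : ℝ → Euc d}, MemLp k 2 (vol a b) → IntegrableOn k (Ioo a b) :=
    fun hk => hk.integrable (by norm_num)
  have hm : ∀ {k : ℝ → Euc d} {φ : ℝ → ℝ}, MemLp k 2 (vol a b) → Continuous φ →
      HasCompactSupport φ → Integrable (fun x => φ x • k x) (vol a b) := by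
    intro k φ hk hφ hc
    obtain ⟨C, hC⟩ := hφ.bounded_above_of_compact_support hc
    exact (hi hk).bdd_smul C hφ.aestronglyMeasurable (Filter.Eventually.of_forall hC)
  have key : ∀ᵐ x : ℝ, x ∈ Ioo a b → (g - g') x = 0 := by
    refine isOpen_Ioo.ae_eq_zero_of_integral_contDiff_smul_eq_zero ?_ ?_
    · exact ((hi h.memLp_deriv).sub (hi h'.memLp_deriv)).locallyIntegrableOn
    · intro φ h1 h2 h3
      have e1 := h.integral_eq φ h1 h2 h3
      have e2 := h'.integral_eq φ h1 h2 h3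
      have e3 : ∫ x in Ioo a b, deriv φ x • f x = ∫ x in Ioo a b, deriv φ x • f' x :=
        integral_congr_ae (by filter_upwards [hff] with x hx; rw [hx])
      have e4 : ∫ x, φ x • (g - g') x = ∫ x in Ioo a b, φ x • (g - g') x := by
        refine (setIntegral_eq_integral_of_forall_compl_eq_zero fun x hx => ?_).symm
        rw [image_eq_zero_of_notMem_tsupport (fun hx' => hx (h3 hx')), zero_smul]
      rw [e4]
      simp only [Pi.sub_apply, smul_sub]
      rw [integral_sub (hm h.memLp_deriv h1.continuous h2) (hm h'.memLp_deriv h1.continuous h2),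
        sub_eq_zero]
      rw [e1, e2] at e3
      exact neg_injective e3
  refine (ae_restrict_iff' measurableSet_Ioo).2 ?_
  filter_upwards [key] with x hx hxm
  exact sub_eq_zero.1 (hx hxm)

/-- Weak derivatives are linear. -/
theorem HasH1Deriv.add {d : ℕ} {a b : ℝ} {f f' g g' : ℝ → Euc d} (h : HasH1Deriv a b f g)
    (h' : HasH1Deriv a b f' g') : HasH1Deriv a b (f + f') (g + g') := by
  have hm : ∀ {k : ℝ → Euc d} {φ : ℝ → ℝ}, MemLp k 2 (vol a b) → Continuous φ →
      HasCompactSupport φ → Integrable (fun x => φ x • k x) (vol a b) := by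
    intro k φ hk hφ hc
    obtain ⟨C, hC⟩ := hφ.bounded_above_of_compact_support hc
    exact (hk.integrable (by norm_num)).bdd_smul C hφ.aestronglyMeasurable
      (Filter.Eventually.of_forall hC)
  refine ⟨h.memLp.add h'.memLp, h.memLp_deriv.add h'.memLp_deriv, fun φ h1 h2 h3 => ?_⟩
  have hd : Continuous (deriv φ) := h1.continuous_deriv (by simp)
  simp only [Pi.add_apply, smul_add]
  rw [integral_add (hm h.memLp hd h2.deriv) (hm h'.memLp hd h2.deriv),
    integral_add (hm h.memLp_deriv h1.continuous h2) (hm h'.memLp_deriv h1.continuous h2),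
    h.integral_eq φ h1 h2 h3, h'.integral_eq φ h1 h2 h3, neg_add]

theorem HasH1Deriv.const_smul {d : ℕ} {a b : ℝ} {f g : ℝ → Euc d} (c : ℝ)
    (h : HasH1Deriv a b f g) : HasH1Deriv a b (c • f) (c • g) := by
  refine ⟨h.memLp.const_smul c, h.memLp_deriv.const_smul c, fun φ h1 h2 h3 => ?_⟩
  simp only [Pi.smul_apply, smul_comm _ c]
  rw [integral_smul, integral_smul, h.integral_eq φ h1 h2 h3, smul_neg]

theorem HasH1Deriv.congr {d : ℕ} {a b : ℝ} {f f' g g' : ℝ → Euc d} (h : HasH1Deriv a b f g)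
    (hf : f =ᵐ[vol a b] f') (hg : g =ᵐ[vol a b] g') : HasH1Deriv a b f' g' := by
  refine ⟨h.memLp.ae_eq hf, h.memLp_deriv.ae_eq hg, fun φ h1 h2 h3 => ?_⟩
  have e1 : ∫ x in Ioo a b, deriv φ x • f x = ∫ x in Ioo a b, deriv φ x • f' x :=
    integral_congr_ae (by filter_upwards [hf] with x hx; rw [hx])
  have e2 : ∫ x in Ioo a b, φ x • g x = ∫ x in Ioo a b, φ x • g' x :=
    integral_congr_ae (by filter_upwards [hg] with x hx; rw [hx])
  rw [← e1, ← e2, h.integral_eq φ h1 h2 h3]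

/-! ### The Hamiltonian density and the port-Hamiltonian operator -/

/-- `ℋ : (a, b) → ℝ^{d×d}` is measurable with symmetric values, and there are `m, M > 0` with
`m ≤ ℋ(x) ≤ M` in the sense of positive definiteness for all `x ∈ (a, b)`. (The values of `ℋ`
outside `(a, b)` play no role.) -/
structure IsDensity {d : ℕ} (a b : ℝ) (ℋ : ℝ → Matrix (Fin d) (Fin d) ℝ) : Prop where
  measurable : ∀ i j, Measurable fun x : Ioo a b => ℋ x i j
  symm : ∀ x ∈ Ioo a b, (ℋ x).transpose = ℋ x
  bounds : ∃ m M : ℝ, 0 < m ∧ 0 < M ∧ ∀ x ∈ Ioo a b,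
    (ℋ x - m • (1 : Matrix (Fin d) (Fin d) ℝ)).PosSemidef ∧
      (M • (1 : Matrix (Fin d) (Fin d) ℝ) - ℋ x).PosSemidef

/-- The product `ℋu`, for `u` in `L₂(a, b)^d`. -/
def mulH {d : ℕ} {a b : ℝ} (ℋ : ℝ → Matrix (Fin d) (Fin d) ℝ) (u : L2 d a b) : ℝ → Euc d :=
  fun x => act (ℋ x) (u x)

/-- The inner product `⟨u, v⟩_H = ⟨ℋu, v⟩` of the Hilbert space `H`, which is `L₂(a, b)^d` as a
vector space. -/
def innerH {d : ℕ} {a b : ℝ} (ℋ : ℝ → Matrix (Fin d) (Fin d) ℝ) (u v : L2 d a b) : ℝ :=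
  ∫ x in Ioo a b, ⟪mulH ℋ u x, v x⟫_ℝ

theorem mulH_add {d : ℕ} {a b : ℝ} (ℋ : ℝ → Matrix (Fin d) (Fin d) ℝ) (u v : L2 d a b) :
    mulH ℋ (u + v) =ᵐ[vol a b] mulH ℋ u + mulH ℋ v := by
  filter_upwards [Lp.coeFn_add u v] with x hx
  rw [Pi.add_apply, mulH, hx, Pi.add_apply, map_add]
  rfl

theorem mulH_smul {d : ℕ} {a b : ℝ} (ℋ : ℝ → Matrix (Fin d) (Fin d) ℝ) (c : ℝ) (u : L2 d a b) :
    mulH ℋ (c • u) =ᵐ[vol a b] c • mulH ℋ u := by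
  filter_upwards [Lp.coeFn_smul c u] with x hx
  rw [Pi.smul_apply, mulH, hx, Pi.smul_apply, map_smul]
  rfl

/-- The graph of the operator `u ↦ P₁ (ℋu)' + P₀ ℋu` on its maximal domain, which consists of all
`u` in `H` with `ℋu` in `H¹(a, b)^d`. -/
def maxGraph {d : ℕ} (a b : ℝ) (P₁ P₀ : Matrix (Fin d) (Fin d) ℝ)
    (ℋ : ℝ → Matrix (Fin d) (Fin d) ℝ) : Submodule ℝ (L2 d a b × L2 d a b) where
  carrier := {p | ∃ g, HasH1Deriv a b (mulH ℋ p.1) g ∧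
    p.2 =ᵐ[vol a b] fun x => act P₁ (g x) + act P₀ (mulH ℋ p.1 x)}
  zero_mem' := by
    have h0 : (fun _ => 0 : ℝ → Euc d) =ᵐ[vol a b] mulH ℋ (0 : L2 d a b) := by
      filter_upwards [Lp.coeFn_zero (Euc d) 2 (vol a b)] with x hx
      rw [mulH, hx, Pi.zero_apply, map_zero]
    refine ⟨fun _ => 0, HasH1Deriv.congr (f := fun _ => 0) ⟨MemLp.zero', MemLp.zero', by simp⟩
      h0 (Filter.EventuallyEq.refl _ _), ?_⟩
    filter_upwards [h0, Lp.coeFn_zero (Euc d) 2 (vol a b)] with x hx hx'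
    simp only [Prod.fst_zero, Prod.snd_zero]
    rw [← hx, hx', Pi.zero_apply, map_zero, map_zero, add_zero]
  add_mem' := by
    rintro ⟨u, f⟩ ⟨v, k⟩ ⟨g, hg, hf⟩ ⟨g', hg', hk⟩
    refine ⟨g + g', (hg.add hg').congr (mulH_add ℋ u v).symm (Filter.EventuallyEq.refl _ _), ?_⟩
    filter_upwards [hf, hk, Lp.coeFn_add f k, mulH_add ℋ u v] with x h1 h2 h3 h4
    simp only [Prod.mk_add_mk] at *
    rw [h3, h4, Pi.add_apply, h1, h2]
    simp only [Pi.add_apply, map_add]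
    abel
  smul_mem' := by
    rintro c ⟨u, f⟩ ⟨g, hg, hf⟩
    refine ⟨c • g, (hg.const_smul c).congr (mulH_smul ℋ c u).symm (Filter.EventuallyEq.refl _ _),
      ?_⟩
    filter_upwards [hf, Lp.coeFn_smul c f, mulH_smul ℋ c u] with x h1 h2 h3
    simp only [Prod.smul_mk] at *
    rw [h2, h3, Pi.smul_apply, h1]
    simp only [Pi.smul_apply, map_smul, smul_add]

theorem maxGraph_singleValued {d : ℕ} (a b : ℝ) (P₁ P₀ : Matrix (Fin d) (Fin d) ℝ)
    (ℋ : ℝ → Matrix (Fin d) (Fin d) ℝ) (p : L2 d a b × L2 d a b)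
    (hp : p ∈ maxGraph a b P₁ P₀ ℋ) (h0 : p.1 = 0) : p.2 = 0 := by
  obtain ⟨u, f⟩ := p
  obtain ⟨g, hg, hf⟩ := hp
  obtain ⟨g', hg', hf'⟩ := (maxGraph a b P₁ P₀ ℋ).zero_mem
  simp only at h0
  subst h0
  have := hg.ae_eq hg' (Filter.EventuallyEq.refl _ _)
  refine Lp.ext ?_
  filter_upwards [this, hf, hf'] with x h1 h2 h3
  simp only [Prod.fst_zero, Prod.snd_zero] at *
  rw [h2, h3, h1]

/-- The port-Hamiltonian operator `u ↦ P₁ (ℋu)' + P₀ ℋu`, restricted to the subspace `D` (which is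
meant to be contained in the maximal domain, and is then the domain of the operator). -/
def portHamiltonian {d : ℕ} (a b : ℝ) (P₁ P₀ : Matrix (Fin d) (Fin d) ℝ)
    (ℋ : ℝ → Matrix (Fin d) (Fin d) ℝ) (D : Submodule ℝ (L2 d a b)) :
    L2 d a b →ₗ.[ℝ] L2 d a b :=
  (maxGraph a b P₁ P₀ ℋ).toLinearPMap.domRestrict D

/-- The operator `portHamiltonian` acts as announced. -/
theorem portHamiltonian_apply {d : ℕ} (a b : ℝ) (P₁ P₀ : Matrix (Fin d) (Fin d) ℝ)
    (ℋ : ℝ → Matrix (Fin d) (Fin d) ℝ) (D : Submodule ℝ (L2 d a b))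
    (u : (portHamiltonian a b P₁ P₀ ℋ D).domain) :
    ∃ g, HasH1Deriv a b (mulH ℋ (u : L2 d a b)) g ∧
      (portHamiltonian a b P₁ P₀ ℋ D u : L2 d a b) =ᵐ[vol a b]
        fun x => act P₁ (g x) + act P₀ (mulH ℋ (u : L2 d a b) x) := by
  have h := Submodule.mem_graph_toLinearPMap (maxGraph_singleValued a b P₁ P₀ ℋ) ⟨u.1, u.2.2⟩
  exact h

theorem portHamiltonian_domain {d : ℕ} (a b : ℝ) (P₁ P₀ : Matrix (Fin d) (Fin d) ℝ)
    (ℋ : ℝ → Matrix (Fin d) (Fin d) ℝ)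
    (D : Submodule ℝ (L2 d a b)) (hD : ∀ u ∈ D, MemH1 a b (mulH ℋ u)) :
    (portHamiltonian a b P₁ P₀ ℋ D).domain = D := by
  refine inf_eq_left.2 fun u hu => ?_
  obtain ⟨g, hg⟩ := hD u hu
  have h1 : MemLp (fun x => act P₁ (g x) + act P₀ (mulH ℋ u x)) 2 (vol a b) :=
    ((act P₁).comp_memLp' hg.memLp_deriv).add ((act P₀).comp_memLp' hg.memLp)
  exact ⟨(u, h1.toLp _), ⟨g, hg, h1.coeFn_toLp⟩, rfl⟩

/-! ### The matrices `Q₊` and `Q₋` -/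

open Classical in
/-- The square root of a positive operator `T`: the (unique) positive operator `R` with
`R ∘ R = T`. (If `T` is not positive, the value is `0`.) -/
def posSqrt {F : Type*} [NormedAddCommGroup F] [InnerProductSpace ℝ F] [CompleteSpace F]
    (T : F →L[ℝ] F) : F →L[ℝ] F :=
  if h : ∃ R : F →L[ℝ] F, R.IsPositive ∧ R ∘L R = T then h.choose else 0

/-- Existence of the square root in finite dimension. -/
theorem exists_posSqrt {F : Type*} [NormedAddCommGroup F] [InnerProductSpace ℝ F]
    [FiniteDimensional ℝ F] [CompleteSpace F] (T : F →L[ℝ] F) (hT : T.IsPositive) :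
    ∃ R : F →L[ℝ] F, R.IsPositive ∧ R ∘L R = T := by
  have hS : (T : F →ₗ[ℝ] F).IsSymmetric := hT.isSymmetric
  set e := hS.eigenvectorBasis rfl with he
  set r := hS.eigenvalues rfl with hr
  have hTe : ∀ i, T (e i) = r i • e i := fun i => hS.apply_eigenvectorBasis rfl i
  have hr0 : ∀ i, 0 ≤ r i := fun i => by
    have h := hT.inner_nonneg_left (e i)
    rwa [hTe, real_inner_smul_left, real_inner_self_eq_norm_sq, e.norm_eq_one, one_pow,
      mul_one] at h
  let R : F →L[ℝ] F := ∑ i, √(r i) • (innerSL ℝ (e i)).smulRight (e i)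
  have hRx : ∀ x, R x = ∑ i, √(r i) • ⟪e i, x⟫_ℝ • e i := fun x => by
    simp [R]
  have hRe : ∀ i, R (e i) = √(r i) • e i := fun i => by
    rw [hRx, Finset.sum_eq_single i]
    · simp
    · intro j _ hj
      rw [e.orthonormal.2 hj, zero_smul, smul_zero]
    · simp
  refine ⟨R, ⟨fun x y => ?_, fun x => ?_⟩, ?_⟩
  · simp only [ContinuousLinearMap.coe_coe, hRx, sum_inner, inner_sum, real_inner_smul_left,
      real_inner_smul_right]
    refine Finset.sum_congr rfl fun i _ => ?_
    rw [real_inner_comm x (e i)]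
    ring
  · simp only [ContinuousLinearMap.reApplyInnerSelf_apply, hRx, sum_inner, real_inner_smul_left,
      RCLike.re_to_real]
    exact Finset.sum_nonneg fun i _ =>
      mul_nonneg (Real.sqrt_nonneg _) (mul_self_nonneg _)
  · refine ContinuousLinearMap.coe_injective (e.toBasis.ext fun i => ?_)
    simp only [OrthonormalBasis.coe_toBasis, ContinuousLinearMap.coe_coe,
      ContinuousLinearMap.comp_apply, hRe, map_smul, smul_smul, Real.mul_self_sqrt (hr0 i), hTe]

/-- `E₊`, the span of the eigenvectors of `P` for positive eigenvalues. -/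
def Eplus {d : ℕ} (P : Matrix (Fin d) (Fin d) ℝ) : Submodule ℝ (Euc d) :=
  Submodule.span ℝ {v | ∃ r : ℝ, 0 < r ∧ act P v = r • v}

/-- `E₋`, the span of the eigenvectors of `P` for negative eigenvalues. -/
def Eminus {d : ℕ} (P : Matrix (Fin d) (Fin d) ℝ) : Submodule ℝ (Euc d) :=
  Submodule.span ℝ {v | ∃ r : ℝ, r < 0 ∧ act P v = r • v}

/-- The compression `ι* A ι : E → E` of a matrix `A` to a subspace `E`, where `ι : E → ℝ^d` is the
inclusion. Its adjoint `ι*` is the orthogonal projection, regarded as a map onto `E`. -/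
def compression {d : ℕ} (E : Submodule ℝ (Euc d)) (A : Matrix (Fin d) (Fin d) ℝ) : E →L[ℝ] E :=
  E.orthogonalProjectionOnto ∘L act A ∘L E.subtypeL

/-- The matrix of `ι R ι* : ℝ^d → ℝ^d`, for an operator `R` on a subspace `E` with inclusion
`ι : E → ℝ^d`. -/
def inflate {d : ℕ} (E : Submodule ℝ (Euc d)) (R : E →L[ℝ] E) : Matrix (Fin d) (Fin d) ℝ :=
  (Matrix.toEuclideanCLM (n := Fin d) (𝕜 := ℝ)).symm
    (E.subtypeL ∘L R ∘L E.orthogonalProjectionOnto)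

/-- `Q₊ = ι₊ (ι₊* P ι₊)^{1/2} ι₊*`. -/
def Qplus {d : ℕ} (P : Matrix (Fin d) (Fin d) ℝ) : Matrix (Fin d) (Fin d) ℝ :=
  inflate (Eplus P) (posSqrt (compression (Eplus P) P))

/-- `Q₋ = ι₋ (ι₋* (-P) ι₋)^{1/2} ι₋*`. -/
def Qminus {d : ℕ} (P : Matrix (Fin d) (Fin d) ℝ) : Matrix (Fin d) (Fin d) ℝ :=
  inflate (Eminus P) (posSqrt (compression (Eminus P) (-P)))

/-! ### Boundary conditions -/

/-- All `u` in `H` with `ℋu` in `H¹(a, b)^d` and `W ((ℋu)(b), (ℋu)(a)) = 0`. -/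
def domW {d : ℕ} (a b : ℝ) (ℋ : ℝ → Matrix (Fin d) (Fin d) ℝ)
    (W : Matrix (Fin d) (Fin d ⊕ Fin d) ℝ) : Set (L2 d a b) :=
  {u | MemH1 a b (mulH ℋ u) ∧
    W.mulVec (Sum.elim (contRep a b (mulH ℋ u) b) (contRep a b (mulH ℋ u) a)) = 0}

/-- `Q₊ (ℋu)(b) + Q₋ (ℋu)(a)`. -/
def bdryOut {d : ℕ} {a b : ℝ} (P₁ : Matrix (Fin d) (Fin d) ℝ)
    (ℋ : ℝ → Matrix (Fin d) (Fin d) ℝ) (u : L2 d a b) : Euc d :=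
  act (Qplus P₁) (contRep a b (mulH ℋ u) b) + act (Qminus P₁) (contRep a b (mulH ℋ u) a)

/-- `Q₊ (ℋu)(a) + Q₋ (ℋu)(b)`. -/
def bdryIn {d : ℕ} {a b : ℝ} (P₁ : Matrix (Fin d) (Fin d) ℝ)
    (ℋ : ℝ → Matrix (Fin d) (Fin d) ℝ) (u : L2 d a b) : Euc d :=
  act (Qplus P₁) (contRep a b (mulH ℋ u) a) + act (Qminus P₁) (contRep a b (mulH ℋ u) b)

/-- All `u` in `H` with `ℋu` in `H¹(a, b)^d` and
`Q₊ (ℋu)(a) + Q₋ (ℋu)(b) = M (Q₊ (ℋu)(b) + Q₋ (ℋu)(a))`. -/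
def domM {d : ℕ} (a b : ℝ) (P₁ : Matrix (Fin d) (Fin d) ℝ)
    (ℋ : ℝ → Matrix (Fin d) (Fin d) ℝ) (M : Matrix (Fin d) (Fin d) ℝ) : Set (L2 d a b) :=
  {u | MemH1 a b (mulH ℋ u) ∧ bdryIn P₁ ℋ u = act M (bdryOut P₁ ℋ u)}

/-- The block matrix `B = (-P₁ P₁; 1 1)`. -/
def blockB {d : ℕ} (P₁ : Matrix (Fin d) (Fin d) ℝ) : Matrix (Fin d ⊕ Fin d) (Fin d ⊕ Fin d) ℝ :=
  Matrix.fromBlocks (-P₁) P₁ 1 1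

/-- The block matrix `Σ = (0 1; 1 0)`. -/
def blockSwap (d : ℕ) : Matrix (Fin d ⊕ Fin d) (Fin d ⊕ Fin d) ℝ :=
  Matrix.fromBlocks 0 1 1 0

/-- The matrix inequality `W B⁻¹ Σ (W B⁻¹)* ≥ 0`. -/
def WCondition {d : ℕ} (P₁ : Matrix (Fin d) (Fin d) ℝ) (W : Matrix (Fin d) (Fin d ⊕ Fin d) ℝ) :
    Prop :=
  (W * (blockB P₁)⁻¹ * blockSwap d * (W * (blockB P₁)⁻¹).transpose).PosSemidef

end PortHamiltonian

end

/-!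
The proof rests on one identity. For `u` in the maximal domain put `v = ℋu` and
`y = Q₊ v(b) + Q₋ v(a)`, `z = Q₊ v(a) + Q₋ v(b)`. Integration by parts gives
`2 ⟨𝒜u, u⟩_H = ⟨P₁ v(b), v(b)⟩ - ⟨P₁ v(a), v(a)⟩`, the term with `P₀` dropping out by skew symmetry.
Since `P₁ = Q₊² - Q₋²` and `Q₊ Q₋ = 0`, the right hand side is `‖y‖² - ‖z‖²` (`innerH_eq`). The map
`T : (v(b), v(a)) ↦ (y, z)` is invertible because `Q₊² + Q₋² = |P₁|` is, and all boundary values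
occur, so `(y, z)` ranges over all of `ℝ^d × ℝ^d` (`exists_bdryOut_bdryIn`). Accretivity is therefore
a statement about a subspace of `ℝ^d × ℝ^d`: that `‖z‖ ≤ ‖y‖` holds on it.

* In these coordinates `W = (V₁ V₂) T`, and the condition on `W` reads `V₁ y + V₂ z = 0`. If the
  operator is accretive, then `V₂` is one-to-one, hence invertible, and `M = -V₂⁻¹ V₁` is a
  contraction (`exists_domW_eq_domM_of_accretive`); no assumption on the rank of `W` is needed. The
  matrix inequality says `V₁ V₁* ≤ V₂ V₂*` (`WCondition_iff`), which together with full rank gives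
  the same conclusion (`exists_domW_eq_domM_of_rank`). In both cases `W = V₂ (-M 1) T`, which is the
  asserted formula with `K = V₂` (`exists_eq_mul_of_domW_eq_domM`).
* For a contraction `M` the operator with boundary condition `z = M y` is accretive. To see that
  `1 + 𝒜` is onto (`exists_mem_domM`), solve the differential equation
  `v' = P₁⁻¹ (f - P₀ v - ℋ⁻¹ v)`, whose coefficients are merely measurable
  (`exists_isPrimitive_linear`), and correct the boundary values by a solution of the homogeneous
  equation. This is possible by counting dimensions: on the space of homogeneous solutions
  `u ↦ z - M y` is one-to-one by the energy identity, and `u ↦ v(a)` is onto.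
* If `𝒜` is m-accretive, then the relation formed by all `(y, z)` extends to the graph of a
  contraction `M` (`exists_contraction`). The operator with boundary condition `z = M y` extends `𝒜`,
  and `1 +` this operator is one-to-one (`eq_of_add_eq_add`) while `1 + 𝒜` is already onto, so the
  two operators agree.
-/

noncomputable section

namespace PortHamiltonian

/-! ### Primitives of integrable functions -/

/-- `v` is on `[a, b]` a primitive of the integrable function `g`. -/
structure IsPrimitive {E : Type*} [NormedAddCommGroup E] [NormedSpace ℝ E] (a b : ℝ)
    (v g : ℝ → E) : Prop where
  integrable : IntervalIntegrable g volume a b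
  eq_add : ∀ x ∈ Icc a b, v x = v a + ∫ t in a..x, g t

theorem IsPrimitive.continuousOn {E : Type*} [NormedAddCommGroup E] [NormedSpace ℝ E]
    {a b : ℝ} {v g : ℝ → E} (h : IsPrimitive a b v g) (hab : a ≤ b) :
    ContinuousOn v (Icc a b) := by
  have h1 := intervalIntegral.continuousOn_primitive_interval (μ := volume) (f := g) (a := a)
    (b := b) ((intervalIntegrable_iff' (by simp)).1 h.integrable)
  rw [uIcc_of_le hab] at h1
  exact (continuousOn_const.add h1).congr h.eq_add

theorem IsPrimitive.comp_clm {E F : Type*} [NormedAddCommGroup E] [NormedSpace ℝ E]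
    [CompleteSpace E] [NormedAddCommGroup F] [NormedSpace ℝ F] [CompleteSpace F]
    {a b : ℝ} {v g : ℝ → E} (h : IsPrimitive a b v g) (L : E →L[ℝ] F) :
    IsPrimitive a b (fun x => L (v x)) (fun x => L (g x)) := by
  refine ⟨?_, fun x hx => ?_⟩
  · have := h.integrable
    exact ⟨L.integrable_comp this.1, L.integrable_comp this.2⟩
  · have hi : IntervalIntegrable g volume a x := h.integrable.mono_set (by
      rw [uIcc_of_le hx.1, uIcc_of_le (hx.1.trans hx.2)]; exact Icc_subset_Icc_right hx.2)
    rw [L.intervalIntegral_comp_comm hi, ← map_add, ← h.eq_add x hx]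

theorem IsPrimitive.coord {d : ℕ} {a b : ℝ} {v g : ℝ → Euc d} (h : IsPrimitive a b v g)
    (i : Fin d) : IsPrimitive a b (fun x => v x i) (fun x => g x i) :=
  h.comp_clm (EuclideanSpace.proj (𝕜 := ℝ) i)

theorem IsPrimitive.of_contDiff {E : Type*} [NormedAddCommGroup E] [NormedSpace ℝ E]
    [CompleteSpace E] {φ : ℝ → E} (a b : ℝ) (h : ContDiff ℝ ∞ φ) :
    IsPrimitive a b φ (deriv φ) := by
  have hd : Continuous (deriv φ) := h.continuous_deriv (by simp)
  refine ⟨hd.intervalIntegrable _ _, fun x _ => ?_⟩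
  rw [intervalIntegral.integral_deriv_eq_sub (fun y _ => (h.differentiable (by simp)) y)
    (hd.intervalIntegrable _ _)]
  abel

/-- The product rule in integrated form. -/
theorem IsPrimitive.integral_mul {a b : ℝ} {v g w k : ℝ → ℝ} (hab : a ≤ b)
    (hv : IsPrimitive a b v g) (hw : IsPrimitive a b w k) :
    ∫ x in a..b, (g x * w x + v x * k x) = v b * w b - v a * w a := by
  have key : ∀ {v g : ℝ → ℝ}, IsPrimitive a b v g →
      AbsolutelyContinuousOnInterval (fun x => v a + ∫ t in a..x, g t) a b ∧
      ∀ᵐ x, x ∈ uIcc a b → deriv (fun x => v a + ∫ t in a..x, g t) x = g x := by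
    intro v g h
    refine ⟨AbsolutelyContinuousOnInterval.add (f := fun _ => v a)
      (ContDiffOn.absolutelyContinuousOnInterval contDiffOn_const)
      (h.integrable.absolutelyContinuousOnInterval_intervalIntegral left_mem_uIcc), ?_⟩
    filter_upwards [h.integrable.ae_hasDerivAt_integral] with x hx hxm
    exact ((hx hxm a left_mem_uIcc).const_add _).deriv
  obtain ⟨a1, d1⟩ := key hv
  obtain ⟨a2, d2⟩ := key hw
  have h := a1.integral_deriv_mul_eq_sub a2
  have hb : b ∈ Icc a b := right_mem_Icc.2 hab
  have ha : a ∈ Icc a b := left_mem_Icc.2 hab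
  simp only [← hv.eq_add b hb, ← hw.eq_add b hb, ← hv.eq_add a ha, ← hw.eq_add a ha] at h
  rw [← h]
  refine intervalIntegral.integral_congr_ae ?_
  filter_upwards [d1, d2] with x h1 h2 hx
  have hx' := uIoc_subset_uIcc hx
  rw [h1 hx', h2 hx']
  rw [uIcc_of_le hab] at hx'
  rw [← hv.eq_add x hx', ← hw.eq_add x hx']

theorem IsPrimitive.intervalIntegrable_mul {a b : ℝ} {v g w k : ℝ → ℝ} (hab : a ≤ b)
    (hv : IsPrimitive a b v g) (hw : IsPrimitive a b w k) :
    IntervalIntegrable (fun x => g x * w x + v x * k x) volume a b :=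
  (hv.integrable.mul_continuousOn (by rw [uIcc_of_le hab]; exact hw.continuousOn hab)).add
    (hw.integrable.continuousOn_mul (by rw [uIcc_of_le hab]; exact hv.continuousOn hab))

theorem IsPrimitive.integral_inner {d : ℕ} {a b : ℝ} {v g w k : ℝ → Euc d} (hab : a ≤ b)
    (hv : IsPrimitive a b v g) (hw : IsPrimitive a b w k) :
    ∫ x in a..b, (⟪g x, w x⟫_ℝ + ⟪v x, k x⟫_ℝ) = ⟪v b, w b⟫_ℝ - ⟪v a, w a⟫_ℝ := by
  have hvi := hv.coord
  have hwi := hw.coord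
  have e : ∀ p q : Euc d, ⟪p, q⟫_ℝ = ∑ i, p i * q i := fun p q => by
    simp [PiLp.inner_apply, mul_comm]
  simp only [e, ← Finset.sum_add_distrib, ← Finset.sum_sub_distrib]
  rw [intervalIntegral.integral_finsetSum fun i _ => (hvi i).intervalIntegrable_mul hab (hwi i)]
  exact Finset.sum_congr rfl fun i _ => (hvi i).integral_mul hab (hwi i)

theorem intervalIntegrable_of_memLp {d : ℕ} {a b : ℝ} (hab : a ≤ b) {g : ℝ → Euc d}
    (hg : MemLp g 2 (vol a b)) : IntervalIntegrable g volume a b :=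
  (intervalIntegrable_iff_integrableOn_Ioo_of_le hab).2 (hg.integrable (by norm_num))

theorem memLp_of_continuousOn {d : ℕ} {a b : ℝ} {v : ℝ → Euc d} (hv : ContinuousOn v (Icc a b)) :
    MemLp v 2 (vol a b) := by
  obtain ⟨C, hC⟩ := isCompact_Icc.exists_bound_of_continuousOn hv
  refine MemLp.of_bound ((hv.mono Ioo_subset_Icc_self).aestronglyMeasurable measurableSet_Ioo) C ?_
  filter_upwards [ae_restrict_mem measurableSet_Ioo] with x hx using hC x (Ioo_subset_Icc_self hx)

theorem eq_zero_of_tsupport_subset_Ioo {E : Type*} [Zero E] {φ : ℝ → E} {a b x : ℝ}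
    (h : tsupport φ ⊆ Ioo a b) (hx : x ∉ Ioo a b) : φ x = 0 :=
  image_eq_zero_of_notMem_tsupport fun hx' => hx (h hx')

theorem setIntegral_eq_intervalIntegral {E : Type*} [NormedAddCommGroup E] [NormedSpace ℝ E]
    {a b : ℝ} (hab : a ≤ b) (f : ℝ → E) : ∫ x in Ioo a b, f x = ∫ x in a..b, f x := by
  rw [intervalIntegral.integral_of_le hab, integral_Ioc_eq_integral_Ioo]

/-- A primitive of a square integrable function lies in `H¹`. -/
theorem IsPrimitive.hasH1Deriv {d : ℕ} {a b : ℝ} {v g : ℝ → Euc d} (hab : a ≤ b)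
    (hv : IsPrimitive a b v g) (hg : MemLp g 2 (vol a b)) : HasH1Deriv a b v g := by
  refine ⟨memLp_of_continuousOn (hv.continuousOn hab), hg, fun φ h1 h2 h3 => ?_⟩
  have hφ := IsPrimitive.of_contDiff a b h1
  have hvc := hv.continuousOn hab
  have hφc : ContinuousOn φ (Icc a b) := hφ.continuousOn hab
  rw [← uIcc_of_le hab] at hvc hφc
  rw [setIntegral_eq_intervalIntegral hab, setIntegral_eq_intervalIntegral hab,
    eq_neg_iff_add_eq_zero, ← intervalIntegral.integral_add
      (hφ.integrable.smul_continuousOn hvc) (hv.integrable.continuousOn_smul hφc)]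
  ext i
  have hvi := hv.coord i
  have h := hφ.integral_mul hab hvi
  rw [eq_zero_of_tsupport_subset_Ioo h3 (by simp), eq_zero_of_tsupport_subset_Ioo h3 (by simp)] at h
  simp only [zero_mul, sub_zero] at h
  have h' := (EuclideanSpace.proj (𝕜 := ℝ) i).intervalIntegral_comp_comm
    ((hφ.integrable.smul_continuousOn hvc).add (hv.integrable.continuousOn_smul hφc))
  exact h'.symm.trans h

/-! ### Functions in `H¹` are primitives -/

/-- A test function on `(a, b)` with integral zero is the derivative of a test function. -/
theorem exists_testFunction_deriv_eq {E : Type*} [NormedAddCommGroup E] [NormedSpace ℝ E]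
    [CompleteSpace E] {a b : ℝ} (hab : a < b) {ψ : ℝ → E} (h1 : ContDiff ℝ ∞ ψ)
    (h2 : HasCompactSupport ψ) (h3 : tsupport ψ ⊆ Ioo a b) (h0 : ∫ x in a..b, ψ x = 0) :
    ∃ φ : ℝ → E, ContDiff ℝ ∞ φ ∧ HasCompactSupport φ ∧ tsupport φ ⊆ Ioo a b ∧ deriv φ = ψ := by
  have hψ : Continuous ψ := h1.continuous
  obtain ⟨c, e, hac, heb, hs⟩ : ∃ c e, a < c ∧ e < b ∧ tsupport ψ ⊆ Icc c e := by
    rcases (tsupport ψ).eq_empty_or_nonempty with h | h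
    · exact ⟨b, a, hab, hab, by simp [h]⟩
    · obtain ⟨c, hc, hc'⟩ := h2.isCompact.exists_isLeast h
      obtain ⟨e, he, he'⟩ := h2.isCompact.exists_isGreatest h
      exact ⟨c, e, (h3 hc).1, (h3 he).2, fun x hx => ⟨hc' hx, he' hx⟩⟩
  have hz : ∀ x, x ∉ Icc c e → ψ x = 0 := fun x hx =>
    image_eq_zero_of_notMem_tsupport fun hx' => hx (hs hx')
  have hd : ∀ x, HasDerivAt (fun x => ∫ t in a..x, ψ t) (ψ x) x := fun x =>
    hψ.integral_hasStrictDerivAt a x |>.hasDerivAt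
  have hd' : deriv (fun x => ∫ t in a..x, ψ t) = ψ := funext fun x => (hd x).deriv
  have hi : ∀ x y, IntervalIntegrable ψ volume x y := fun x y => hψ.intervalIntegrable x y
  have hsupp : Function.support (fun x => ∫ t in a..x, ψ t) ⊆ Icc c e := by
    intro x hx
    by_contra hxn
    refine hx ?_
    rcases lt_or_ge x c with hxc | hxc
    · rw [← intervalIntegral.integral_zero (a := a) (b := x) (E := E) (μ := volume)]
      refine intervalIntegral.integral_congr fun t ht => hz t fun ht' => ?_
      have := (mem_uIcc.1 ht)
      rcases this with h | h <;> linarith [ht'.1, h.2]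
    · have hex : e < x := lt_of_not_ge fun h => hxn ⟨hxc, h⟩
      change ∫ t in a..x, ψ t = 0
      rw [← intervalIntegral.integral_add_adjacent_intervals (hi a b) (hi b x), h0, zero_add,
        ← intervalIntegral.integral_zero (a := b) (b := x) (E := E) (μ := volume)]
      refine intervalIntegral.integral_congr fun t ht => hz t fun ht' => ?_
      have := (mem_uIcc.1 ht)
      rcases this with h | h <;> linarith [ht'.2, h.1]
  refine ⟨fun x => ∫ t in a..x, ψ t, ?_, ?_, ?_, hd'⟩
  · rw [contDiff_infty_iff_deriv, hd']
    exact ⟨fun x => (hd x).differentiableAt, h1⟩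
  · exact HasCompactSupport.of_support_subset_isCompact isCompact_Icc hsupp
  · exact (closure_minimal hsupp isClosed_Icc).trans fun x hx =>
      ⟨hac.trans_le hx.1, hx.2.trans_lt heb⟩

/-- The du Bois-Reymond lemma: a function with vanishing weak derivative is constant. -/
theorem ae_eq_const_of_integral_deriv_smul_eq_zero {d : ℕ} {a b : ℝ} (hab : a < b)
    {f : ℝ → Euc d} (hf : IntegrableOn f (Ioo a b))
    (h : ∀ φ : ℝ → ℝ, ContDiff ℝ ∞ φ → HasCompactSupport φ → tsupport φ ⊆ Ioo a b →
      ∫ x in Ioo a b, deriv φ x • f x = 0) : ∃ c : Euc d, f =ᵐ[vol a b] fun _ => c := by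
  -- a test function `η` with integral `1`
  let η₀ : ContDiffBump ((a + b) / 2) := ⟨(b - a) / 8, (b - a) / 4, by linarith, by linarith⟩
  set η : ℝ → ℝ := η₀.normed volume with hη
  have η1 : ContDiff ℝ ∞ η := η₀.contDiff_normed
  have η2 : HasCompactSupport η := η₀.hasCompactSupport_normed
  have η3 : tsupport η ⊆ Ioo a b := by
    rw [hη, η₀.tsupport_normed_eq, Real.closedBall_eq_Icc]
    intro x hx
    have h1 := hx.1
    have h2 := hx.2
    simp only [η₀] at h1 h2
    constructor <;> linarith
  have supp : ∀ {ψ : ℝ → ℝ} , tsupport ψ ⊆ Ioo a b → ∀ k : ℝ → Euc d,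
      ∫ x, ψ x • k x = ∫ x in Ioo a b, ψ x • k x := by
    intro ψ h3 k
    refine (setIntegral_eq_integral_of_forall_compl_eq_zero fun x hx => ?_).symm
    rw [eq_zero_of_tsupport_subset_Ioo h3 hx, zero_smul]
  have η4 : ∫ x in a..b, η x = 1 := by
    rw [← setIntegral_eq_intervalIntegral hab.le, ← η₀.integral_normed (μ := volume)]
    exact setIntegral_eq_integral_of_forall_compl_eq_zero fun x hx =>
      eq_zero_of_tsupport_subset_Ioo η3 hx
  have hm : ∀ {k : ℝ → Euc d} {φ : ℝ → ℝ}, IntegrableOn k (Ioo a b) → Continuous φ →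
      HasCompactSupport φ → Integrable (fun x => φ x • k x) (vol a b) := by
    intro k φ hk hφ hc
    obtain ⟨C, hC⟩ := hφ.bounded_above_of_compact_support hc
    exact hk.bdd_smul C hφ.aestronglyMeasurable (Filter.Eventually.of_forall hC)
  set c : Euc d := ∫ x in Ioo a b, η x • f x with hc
  refine ⟨c, ?_⟩
  have hfc : IntegrableOn (fun x => f x - c) (Ioo a b) := hf.sub (integrable_const c)
  have key : ∀ᵐ x : ℝ, x ∈ Ioo a b → f x - c = 0 := by
    refine isOpen_Ioo.ae_eq_zero_of_integral_contDiff_smul_eq_zero hfc.locallyIntegrableOn ?_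
    intro ψ p1 p2 p3
    set r : ℝ := ∫ x in a..b, ψ x with hr
    have q3 : tsupport (fun x => ψ x - r * η x) ⊆ Ioo a b := by
      refine (tsupport_sub ψ (fun x => r * η x)).trans (union_subset p3 ?_)
      exact (tsupport_mul_subset_right (f := fun _ => r) (g := η)).trans η3
    obtain ⟨φ, f1, f2, f3, f4⟩ := exists_testFunction_deriv_eq hab
      (ψ := fun x => ψ x - r * η x) (p1.sub (contDiff_const.mul η1))
      (p2.sub (η2.mul_left)) q3 (by
        rw [intervalIntegral.integral_sub (p1.continuous.intervalIntegrable _ _)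
          ((η1.continuous.intervalIntegrable _ _).const_mul r),
          intervalIntegral.integral_const_mul, η4, mul_one, hr, sub_self])
    have h0 := h φ f1 f2 f3
    rw [f4] at h0
    rw [supp p3]
    have e1 : ∀ x, ψ x • (f x - c) = (ψ x - r * η x) • f x + (r • (η x • f x) - ψ x • c) := by
      intro x
      module
    simp only [e1]
    rw [integral_add, h0, integral_sub, integral_smul, integral_smul_const,
      setIntegral_eq_intervalIntegral hab.le ψ, ← hr, ← hc, sub_self, zero_add]
    · exact (hm hf η1.continuous η2).smul r
    · exact hm (integrable_const c) p1.continuous p2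
    · exact hm hf (p1.continuous.sub (continuous_const.mul η1.continuous)) (p2.sub η2.mul_left)
    · exact ((hm hf η1.continuous η2).smul r).sub (hm (integrable_const c) p1.continuous p2)
  refine (ae_restrict_iff' measurableSet_Ioo).2 ?_
  filter_upwards [key] with x hx hxm
  exact sub_eq_zero.1 (hx hxm)

/-- A function in `H¹` agrees almost everywhere with a primitive of its weak derivative. -/
theorem HasH1Deriv.exists_isPrimitive {d : ℕ} {a b : ℝ} (hab : a < b) {f g : ℝ → Euc d}
    (h : HasH1Deriv a b f g) : ∃ v, IsPrimitive a b v g ∧ f =ᵐ[vol a b] v := by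
  have hgi := intervalIntegrable_of_memLp hab.le h.memLp_deriv
  have hp : ∀ c : Euc d, IsPrimitive a b (fun x => c + ∫ t in a..x, g t) g := fun c =>
    ⟨hgi, fun x _ => by simp⟩
  have hw := (hp 0).hasH1Deriv hab.le h.memLp_deriv
  have hdiff := h.add (hw.const_smul (-1))
  obtain ⟨c, hc⟩ := ae_eq_const_of_integral_deriv_smul_eq_zero hab
    (hdiff.memLp.integrable (by norm_num)) fun φ h1 h2 h3 => by
      rw [hdiff.integral_eq φ h1 h2 h3]
      simp
  refine ⟨_, hp c, ?_⟩
  filter_upwards [hc] with x hx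
  rw [← hx, Pi.add_apply, Pi.smul_apply]
  module

theorem eqOn_Icc_of_ae_eq {d : ℕ} {a b : ℝ} (hab : a < b) {v w : ℝ → Euc d}
    (hv : ContinuousOn v (Icc a b)) (hw : ContinuousOn w (Icc a b)) (h : v =ᵐ[vol a b] w) :
    EqOn v w (Icc a b) := by
  have h1 : EqOn v w (Ioo a b) := Measure.eqOn_open_of_ae_eq h isOpen_Ioo
    (hv.mono Ioo_subset_Icc_self) (hw.mono Ioo_subset_Icc_self)
  exact h1.of_subset_closure hv hw Ioo_subset_Icc_self (by rw [closure_Ioo hab.ne])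

/-- `contRep` agrees on `[a, b]` with every continuous representative. -/
theorem contRep_eqOn {d : ℕ} {a b : ℝ} (hab : a < b) {f v : ℝ → Euc d}
    (hv : ContinuousOn v (Icc a b)) (h : f =ᵐ[vol a b] v) : EqOn (contRep a b f) v (Icc a b) := by
  have hex : ∃ v : ℝ → Euc d, ContinuousOn v (Icc a b) ∧ v =ᵐ[vol a b] f := ⟨v, hv, h.symm⟩
  rw [contRep, dif_pos hex]
  exact eqOn_Icc_of_ae_eq hab hex.choose_spec.1 hv (hex.choose_spec.2.trans h)

/-! ### The matrices `Q₊` and `Q₋` -/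

theorem act_mul {d : ℕ} (A B : Matrix (Fin d) (Fin d) ℝ) (x : Euc d) :
    act (A * B) x = act A (act B x) := by
  simp [act, map_mul]

theorem act_one {d : ℕ} (x : Euc d) : act (1 : Matrix (Fin d) (Fin d) ℝ) x = x := by
  simp [act]

theorem act_add {d : ℕ} (A B : Matrix (Fin d) (Fin d) ℝ) (x : Euc d) :
    act (A + B) x = act A x + act B x := by
  simp [act]

theorem act_neg {d : ℕ} (A : Matrix (Fin d) (Fin d) ℝ) (x : Euc d) :
    act (-A) x = -act A x := by
  simp [act]

theorem act_sub {d : ℕ} (A B : Matrix (Fin d) (Fin d) ℝ) (x : Euc d) :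
    act (A - B) x = act A x - act B x := by
  simp [act]

theorem act_transpose {d : ℕ} (A : Matrix (Fin d) (Fin d) ℝ) :
    act A.transpose = ContinuousLinearMap.adjoint (act A) := by
  rw [← ContinuousLinearMap.star_eq_adjoint, act, act, ← map_star, Matrix.star_eq_conjTranspose,
    Matrix.conjTranspose_eq_transpose_of_trivial]

theorem inner_act_left {d : ℕ} (A : Matrix (Fin d) (Fin d) ℝ) (x y : Euc d) :
    ⟪act A x, y⟫_ℝ = ⟪x, act A.transpose y⟫_ℝ := by
  rw [act_transpose, ContinuousLinearMap.adjoint_inner_right]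

theorem act_injective {d : ℕ} : Function.Injective (act (d := d)) :=
  (Matrix.toEuclideanCLM (n := Fin d) (𝕜 := ℝ)).injective

/-- A symmetric operator which is nonnegative on an invariant subspace has a positive
compression. -/
theorem isPositive_compression {d : ℕ} {E : Submodule ℝ (Euc d)} {P : Matrix (Fin d) (Fin d) ℝ}
    (hP : P.transpose = P) (h0 : ∀ v ∈ E, 0 ≤ ⟪act P v, v⟫_ℝ) :
    (compression E P).IsPositive := by
  have key : ∀ x y : E, ⟪compression E P x, y⟫_ℝ = ⟪act P (x : Euc d), (y : Euc d)⟫_ℝ := by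
    intro x y
    simp only [compression, ContinuousLinearMap.comp_apply, Submodule.subtypeL_apply]
    rw [Submodule.inner_orthogonalProjectionOnto_eq_of_mem_right]
  refine ⟨fun x y => ?_, fun x => ?_⟩
  · simp only [ContinuousLinearMap.coe_coe]
    rw [key, real_inner_comm (compression E P y) x, key, inner_act_left, hP, real_inner_comm]
  · rw [ContinuousLinearMap.reApplyInnerSelf_apply, key]
    exact h0 x x.2

theorem posSqrt_spec {F : Type*} [NormedAddCommGroup F] [InnerProductSpace ℝ F]
    [FiniteDimensional ℝ F] [CompleteSpace F] {T : F →L[ℝ] F} (hT : T.IsPositive) :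
    (posSqrt T).IsPositive ∧ posSqrt T ∘L posSqrt T = T := by
  have h := exists_posSqrt T hT
  rw [posSqrt, dif_pos h]
  exact h.choose_spec

theorem act_inflate {d : ℕ} (E : Submodule ℝ (Euc d)) (R : E →L[ℝ] E) (x : Euc d) :
    act (inflate E R) x = R (E.orthogonalProjectionOnto x) := by
  simp [act, inflate]

theorem transpose_inflate {d : ℕ} {E : Submodule ℝ (Euc d)} {R : E →L[ℝ] E}
    (hR : R.IsPositive) : (inflate E R).transpose = inflate E R := by
  refine act_injective (ContinuousLinearMap.ext fun x => ext_inner_left ℝ fun y => ?_)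
  rw [← inner_act_left, act_inflate, act_inflate,
    ← Submodule.inner_orthogonalProjectionOnto_eq_of_mem_left,
    ← Submodule.inner_orthogonalProjectionOnto_eq_of_mem_right]
  exact hR.isSymmetric _ _

section Eigenspaces

variable {d : ℕ} {P : Matrix (Fin d) (Fin d) ℝ}

theorem Eminus_eq_Eplus_neg (P : Matrix (Fin d) (Fin d) ℝ) : Eminus P = Eplus (-P) := by
  rw [Eminus, Eplus]
  congr 1
  ext v
  constructor
  · rintro ⟨r, hr, h⟩
    exact ⟨-r, by linarith, by rw [act_neg, h, neg_smul]⟩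
  · rintro ⟨r, hr, h⟩
    exact ⟨-r, by linarith, by rw [neg_smul, ← h, act_neg, neg_neg]⟩

theorem Qminus_eq_Qplus_neg (P : Matrix (Fin d) (Fin d) ℝ) : Qminus P = Qplus (-P) := by
  have h : ∀ E : Submodule ℝ (Euc d), E = Eplus (-P) →
      inflate E (posSqrt (compression E (-P))) = Qplus (-P) := by
    rintro _ rfl
    rfl
  exact h _ (Eminus_eq_Eplus_neg P)

theorem act_mem_Eplus {v : Euc d} (hv : v ∈ Eplus P) : act P v ∈ Eplus P := by
  refine Submodule.span_induction (p := fun v _ => act P v ∈ Eplus P) ?_ ?_ ?_ ?_ hv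
  · rintro v ⟨r, hr, h⟩
    rw [h]
    exact Submodule.smul_mem _ _ (Submodule.subset_span ⟨r, hr, h⟩)
  · simp
  · intro x y _ _ hx hy
    rw [map_add]
    exact Submodule.add_mem _ hx hy
  · intro c x _ hx
    rw [map_smul]
    exact Submodule.smul_mem _ _ hx

theorem inner_eq_zero_of_mem_Eplus (hP : P.transpose = P) {v w : Euc d} (hv : v ∈ Eplus P)
    {s : ℝ} (hs : s ≤ 0) (hw : act P w = s • w) : ⟪v, w⟫_ℝ = 0 := by
  refine Submodule.span_induction (p := fun v _ => ⟪v, w⟫_ℝ = 0) ?_ ?_ ?_ ?_ hv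
  · rintro v ⟨r, hr, h⟩
    have := inner_act_left P v w
    rw [hP, h, hw, real_inner_smul_left, real_inner_smul_right] at this
    have h2 : (r - s) * ⟪v, w⟫_ℝ = 0 := by linarith
    rcases mul_eq_zero.1 h2 with h3 | h3
    · linarith
    · exact h3
  · simp
  · intro x y _ _ hx hy
    rw [inner_add_left, hx, hy, add_zero]
  · intro c x _ hx
    rw [real_inner_smul_left, hx, mul_zero]

theorem Eminus_le_orthogonal (hP : P.transpose = P) : Eminus P ≤ (Eplus P)ᗮ := by
  refine Submodule.span_le.2 ?_
  rintro w ⟨s, hs, hw⟩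
  exact fun v hv => inner_eq_zero_of_mem_Eplus hP hv hs.le hw

theorem isSymmetric_act (hP : P.transpose = P) : (act P : Euc d →ₗ[ℝ] Euc d).IsSymmetric := by
  intro x y
  have := inner_act_left P x y
  rwa [hP] at this

theorem inner_act_nonneg_of_mem_Eplus (hP : P.transpose = P) {v : Euc d} (hv : v ∈ Eplus P) :
    0 ≤ ⟪act P v, v⟫_ℝ := by
  have hS := isSymmetric_act hP
  set e := hS.eigenvectorBasis finrank_euclideanSpace_fin
  set r := hS.eigenvalues finrank_euclideanSpace_fin
  have he : ∀ i, act P (e i) = r i • e i := fun i =>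
    hS.apply_eigenvectorBasis finrank_euclideanSpace_fin i
  rw [← e.sum_inner_mul_inner]
  refine Finset.sum_nonneg fun i _ => ?_
  rw [inner_act_left, hP, he, real_inner_smul_right, real_inner_comm v (e i)]
  rcases le_or_gt (r i) 0 with h | h
  · rw [inner_eq_zero_of_mem_Eplus hP hv h (he i)]
    simp
  · nlinarith [mul_self_nonneg ⟪v, e i⟫_ℝ]

theorem Eplus_sup_Eminus (hP : P.transpose = P) (hu : IsUnit P) : Eplus P ⊔ Eminus P = ⊤ := by
  have hS := isSymmetric_act hP
  set e := hS.eigenvectorBasis finrank_euclideanSpace_fin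
  set r := hS.eigenvalues finrank_euclideanSpace_fin
  have he : ∀ i, act P (e i) = r i • e i := fun i =>
    hS.apply_eigenvectorBasis finrank_euclideanSpace_fin i
  rw [eq_top_iff, ← e.toBasis.span_eq, Submodule.span_le]
  rintro _ ⟨i, rfl⟩
  rw [OrthonormalBasis.coe_toBasis]
  rcases lt_trichotomy (r i) 0 with h | h | h
  · exact Submodule.mem_sup_right (Submodule.subset_span ⟨r i, h, he i⟩)
  · exfalso
    obtain ⟨u, hu⟩ := hu
    have h1 := act_mul (↑u⁻¹) (↑u) (e i)
    rw [u.inv_mul, act_one, hu, he, h, zero_smul, map_zero] at h1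
    have h2 := e.norm_eq_one i
    rw [h1, norm_zero] at h2
    exact zero_ne_one h2
  · exact Submodule.mem_sup_left (Submodule.subset_span ⟨r i, h, he i⟩)

theorem isPositive_compression_Eplus (hP : P.transpose = P) :
    (compression (Eplus P) P).IsPositive :=
  isPositive_compression hP fun _ => inner_act_nonneg_of_mem_Eplus hP

theorem transpose_Qplus (hP : P.transpose = P) : (Qplus P).transpose = Qplus P :=
  transpose_inflate (posSqrt_spec (isPositive_compression_Eplus hP)).1

theorem act_Qplus_mem (P : Matrix (Fin d) (Fin d) ℝ) (x : Euc d) : act (Qplus P) x ∈ Eplus P := by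
  rw [Qplus, act_inflate]
  exact SetLike.coe_mem _

theorem act_Qplus_eq_zero {x : Euc d} (hx : x ∈ (Eplus P)ᗮ) : act (Qplus P) x = 0 := by
  rw [Qplus, act_inflate,
    Submodule.orthogonalProjectionOnto_eq_zero_iff.2 hx, map_zero]

  simp

theorem act_Qplus_act_Qplus (hP : P.transpose = P) {x : Euc d} (hx : x ∈ Eplus P) :
    act (Qplus P) (act (Qplus P) x) = act P x := by
  have h := DFunLike.congr_fun (posSqrt_spec (isPositive_compression_Eplus hP)).2 ⟨x, hx⟩
  have h1 : (Eplus P).orthogonalProjectionOnto x = ⟨x, hx⟩ :=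
    Submodule.orthogonalProjectionOnto_mem_subspace_eq_self (⟨x, hx⟩ : Eplus P)
  simp only [Qplus, act_inflate]
  rw [Submodule.orthogonalProjectionOnto_mem_subspace_eq_self, h1]
  rw [ContinuousLinearMap.comp_apply] at h
  rw [h]
  simp only [compression, ContinuousLinearMap.comp_apply, Submodule.subtypeL_apply]
  have h2 := Submodule.orthogonalProjectionOnto_mem_subspace_eq_self
    (⟨act P x, act_mem_Eplus hx⟩ : Eplus P)
  exact congrArg Subtype.val h2

theorem transpose_Qminus (hP : P.transpose = P) : (Qminus P).transpose = Qminus P := by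
  rw [Qminus_eq_Qplus_neg]
  exact transpose_Qplus (by rw [Matrix.transpose_neg, hP])

theorem Qplus_mul_Qminus (hP : P.transpose = P) : Qplus P * Qminus P = 0 := by
  refine act_injective (ContinuousLinearMap.ext fun x => ?_)
  rw [act_mul, act_Qplus_eq_zero]
  · simp
  · rw [Qminus_eq_Qplus_neg]
    refine Eminus_le_orthogonal hP ?_
    rw [Eminus_eq_Eplus_neg]
    exact act_Qplus_mem _ _

theorem Qminus_mul_Qplus (hP : P.transpose = P) : Qminus P * Qplus P = 0 := by
  have h := congrArg Matrix.transpose (Qplus_mul_Qminus hP)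
  rwa [Matrix.transpose_mul, transpose_Qplus hP, transpose_Qminus hP, Matrix.transpose_zero] at h

theorem Qplus_sq_sub_Qminus_sq (hP : P.transpose = P) (hu : IsUnit P) :
    Qplus P * Qplus P - Qminus P * Qminus P = P := by
  refine act_injective (ContinuousLinearMap.ext fun x => ?_)
  have hx : x ∈ Eplus P ⊔ Eminus P := by rw [Eplus_sup_Eminus hP hu]; trivial
  obtain ⟨y, hy, z, hz, rfl⟩ := Submodule.mem_sup.1 hx
  have hP' : (-P).transpose = -P := by rw [Matrix.transpose_neg, hP]
  have h1 : act (Qplus P) z = 0 := act_Qplus_eq_zero (Eminus_le_orthogonal hP hz)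
  have h2 : act (Qplus (-P)) y = 0 := by
    refine act_Qplus_eq_zero (Eminus_le_orthogonal hP' ?_)
    rwa [Eminus_eq_Eplus_neg, neg_neg]
  rw [Eminus_eq_Eplus_neg] at hz
  rw [Qminus_eq_Qplus_neg, act_sub, act_mul, act_mul]
  simp only [map_add, h1, h2, add_zero, zero_add]
  rw [act_Qplus_act_Qplus hP hy, act_Qplus_act_Qplus hP' hz, act_neg, sub_neg_eq_add]

/-- `Q₊² + Q₋² = |P|` is invertible, since its square is `P²`; its inverse commutes with `Q₊` and
`Q₋`. -/
theorem exists_inverse_abs (hP : P.transpose = P) (hu : IsUnit P) :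
    ∃ G : Matrix (Fin d) (Fin d) ℝ, Commute G (Qplus P) ∧ Commute G (Qminus P) ∧
      G * (Qplus P * Qplus P + Qminus P * Qminus P) = 1 := by
  set A := Qplus P
  set B := Qminus P
  have hAB : A * B = 0 := Qplus_mul_Qminus hP
  have hBA : B * A = 0 := Qminus_mul_Qplus hP
  set N := A * A + B * B with hN
  have hNN : N * N = P * P := by
    rw [← Qplus_sq_sub_Qminus_sq hP hu, hN]
    have e1 : (A * A + B * B) * (A * A + B * B) - (A * A - B * B) * (A * A - B * B) =
      2 • (A * (A * B) * B) + 2 • (B * (B * A) * A) := by noncomm_ring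
    rw [hAB, hBA] at e1
    simpa [sub_eq_zero] using e1
  have hNu : IsUnit N := by
    have h2 : IsUnit (N * N) := by rw [hNN]; exact hu.mul hu
    exact ((Commute.refl N).isUnit_mul_iff.1 h2).1
  have hdet := (Matrix.isUnit_iff_isUnit_det N).1 hNu
  have hc : ∀ {C : Matrix (Fin d) (Fin d) ℝ}, Commute N C → Commute N⁻¹ C := by
    intro C hC
    have h1 : N⁻¹ * (N * C) * N⁻¹ = N⁻¹ * (C * N) * N⁻¹ := by rw [hC.eq]
    rw [Matrix.nonsing_inv_mul_cancel_left _ _ hdet, ← mul_assoc,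
      Matrix.mul_nonsing_inv_cancel_right _ _ hdet] at h1
    exact h1.symm
  refine ⟨N⁻¹, hc ?_, hc ?_, Matrix.nonsing_inv_mul _ hdet⟩
  · rw [hN, Commute, SemiconjBy, add_mul, mul_add, mul_assoc B, hBA, ← mul_assoc A B, hAB]
    simp [mul_assoc]
  · rw [hN, Commute, SemiconjBy, add_mul, mul_add, mul_assoc A, hAB, ← mul_assoc B A, hBA]
    simp [mul_assoc]

end Eigenspaces

/-! ### Boundary matrices -/

section BoundaryMatrices

variable {d : ℕ} {P : Matrix (Fin d) (Fin d) ℝ}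

/-- Every `d × 2d` matrix is of the form `(V₁ V₂) T` with `T = (Q₊ Q₋; Q₋ Q₊)`. -/
theorem exists_eq_fromCols (hP : P.transpose = P) (hu : IsUnit P)
    (W : Matrix (Fin d) (Fin d ⊕ Fin d) ℝ) :
    ∃ V₁ V₂ : Matrix (Fin d) (Fin d) ℝ,
      W = Matrix.fromCols (V₁ * Qplus P + V₂ * Qminus P) (V₁ * Qminus P + V₂ * Qplus P) := by
  obtain ⟨G, hA, hB, hG⟩ := exists_inverse_abs hP hu
  have hAB := Qplus_mul_Qminus hP
  have hBA := Qminus_mul_Qplus hP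
  obtain ⟨W₁, W₂, rfl⟩ : ∃ W₁ W₂, W = Matrix.fromCols W₁ W₂ :=
    ⟨W.toCols₁, W.toCols₂, (Matrix.fromCols_toCols W).symm⟩
  set A := Qplus P
  set B := Qminus P
  refine ⟨W₁ * (G * A) + W₂ * (G * B), W₁ * (G * B) + W₂ * (G * A), ?_⟩
  have e1 : (W₁ * (G * A) + W₂ * (G * B)) * A + (W₁ * (G * B) + W₂ * (G * A)) * B =
      W₁ * (G * (A * A + B * B)) + W₂ * G * (B * A) + W₂ * G * (A * B) := by noncomm_ring
  have e2 : (W₁ * (G * A) + W₂ * (G * B)) * B + (W₁ * (G * B) + W₂ * (G * A)) * A =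
      W₂ * (G * (A * A + B * B)) + W₁ * G * (B * A) + W₁ * G * (A * B) := by noncomm_ring
  rw [e1, e2, hG, hAB, hBA]
  simp

/-- The map `(v(b), v(a)) ↦ (y, z)` given by `T = (Q₊ Q₋; Q₋ Q₊)` is onto. -/
theorem exists_act_eq (hP : P.transpose = P) (hu : IsUnit P) (y z : Euc d) :
    ∃ p q : Euc d, act (Qplus P) p + act (Qminus P) q = y ∧
      act (Qplus P) q + act (Qminus P) p = z := by
  obtain ⟨G, hA, hB, hG⟩ := exists_inverse_abs hP hu
  have hAB := Qplus_mul_Qminus hP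
  have hBA := Qminus_mul_Qplus hP
  set A := Qplus P
  set B := Qminus P
  have e1 : ∀ x, act A (act A (act G x)) + act B (act B (act G x)) = x := fun x => by
    simp only [← act_mul, ← act_add]
    have : A * (A * G) + B * (B * G) = G * (A * A + B * B) := by
      rw [mul_add, ← mul_assoc G A, hA.eq, ← mul_assoc G B, hB.eq, mul_assoc A, hA.eq,
        mul_assoc B, hB.eq]
    rw [this, hG, act_one]
  have e2 : ∀ x, act A (act B x) = 0 := fun x => by
    rw [← act_mul, hAB]
    simp
  have e3 : ∀ x, act B (act A x) = 0 := fun x => by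
    rw [← act_mul, hBA]
    simp
  refine ⟨act A (act G y) + act B (act G z), act B (act G y) + act A (act G z), ?_, ?_⟩
  · simp only [map_add, e2, e3, add_zero, e1]
  · simp only [map_add, e2, e3, zero_add]
    rw [add_comm, add_comm (act B _)]
    simp [e1]

/-- In the coordinates `(y, z)` the inequality `W B⁻¹ Σ (W B⁻¹)* ≥ 0` says `V₁ V₁* ≤ V₂ V₂*`. -/
theorem WCondition_iff (hP : P.transpose = P) (hu : IsUnit P) (V₁ V₂ : Matrix (Fin d) (Fin d) ℝ) :
    WCondition P
        (Matrix.fromCols (V₁ * Qplus P + V₂ * Qminus P) (V₁ * Qminus P + V₂ * Qplus P)) ↔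
      (V₂ * V₂.transpose - V₁ * V₁.transpose).PosSemidef := by
  obtain ⟨G, hA, hB, hG⟩ := exists_inverse_abs hP hu
  have hAB := Qplus_mul_Qminus hP
  have hBA := Qminus_mul_Qplus hP
  have hAt := transpose_Qplus hP
  have hBt := transpose_Qminus hP
  have hPQ := Qplus_sq_sub_Qminus_sq hP hu
  set A := Qplus P
  set B := Qminus P
  -- `P G²` is the inverse of `P`
  set R : Matrix (Fin d) (Fin d) ℝ := P * (G * G) with hR
  have r1 : ∀ X, G * (A * X) = A * (G * X) := fun X => by rw [← mul_assoc, hA.eq, mul_assoc]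
  have r2 : ∀ X, G * (B * X) = B * (G * X) := fun X => by rw [← mul_assoc, hB.eq, mul_assoc]
  have r3 : ∀ X, A * (B * X) = 0 := fun X => by rw [← mul_assoc, hAB, zero_mul]
  have r4 : ∀ X, B * (A * X) = 0 := fun X => by rw [← mul_assoc, hBA, zero_mul]
  have h4 : A * (A * (A * (A * (G * G)))) + B * (B * (B * (B * (G * G)))) = 1 := by
    have h := congrArg₂ (· * ·) hG hG
    simpa only [mul_add, add_mul, mul_assoc, hA.eq, hB.eq, r1, r2, r3, r4, hAB, hBA, mul_zero,
      add_zero, zero_add, mul_one] using h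
  have hPR : P * R = 1 := by
    rw [hR, ← hPQ]
    simpa only [mul_sub, sub_mul, mul_assoc, r3, r4, mul_zero, sub_zero, zero_sub, sub_neg_eq_add]
      using h4
  have hARA : A * R * A = 1 + B * R * B := by
    rw [hR, ← hPQ, ← h4]
    simp only [mul_sub, sub_mul, mul_assoc, hA.eq, hB.eq, r1, r2, r3, r4, sub_zero, zero_sub,
      neg_mul]
    abel
  have hARB : A * R * B = 0 := by
    rw [hR, ← hPQ]
    simp only [mul_sub, sub_mul, mul_assoc, hB.eq, r2, r3, mul_zero, sub_zero]
  have hBRA : B * R * A = 0 := by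
    rw [hR, ← hPQ]
    simp only [mul_sub, sub_mul, mul_assoc, hA.eq, r1, r4, mul_zero, zero_mul, sub_zero]
  have hRinv : P⁻¹ = R := Matrix.inv_eq_right_inv hPR
  have hRt : R.transpose = R := by rw [← hRinv, Matrix.transpose_nonsing_inv, hP]
  have hinv : (blockB P)⁻¹ = Matrix.fromBlocks (-(2⁻¹ : ℝ) • R) ((2⁻¹ : ℝ) • 1) ((2⁻¹ : ℝ) • R)
      ((2⁻¹ : ℝ) • 1) := by
    refine Matrix.inv_eq_right_inv ?_
    rw [blockB, Matrix.fromBlocks_multiply, ← Matrix.fromBlocks_one]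
    congr 1
    · simp only [neg_mul, Matrix.mul_smul, hPR, neg_smul, mul_neg, neg_neg]
      rw [← add_smul]; norm_num
    · simp
    · simp
    · simp only [Matrix.mul_smul, mul_one]
      rw [← add_smul]; norm_num
  set W₁ := V₁ * A + V₂ * B
  set W₂ := V₁ * B + V₂ * A
  have key : Matrix.fromCols W₁ W₂ * (blockB P)⁻¹ * blockSwap d *
      (Matrix.fromCols W₁ W₂ * (blockB P)⁻¹).transpose =
        (2⁻¹ : ℝ) • (V₂ * V₂.transpose - V₁ * V₁.transpose) := by
    have e1 : W₁ * R * W₁.transpose = V₁ * (A * R * A) * V₁.transpose +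
        V₁ * (A * R * B) * V₂.transpose + V₂ * (B * R * A) * V₁.transpose +
        V₂ * (B * R * B) * V₂.transpose := by
      simp only [W₁, Matrix.transpose_add, Matrix.transpose_mul, hAt, hBt]
      noncomm_ring
    have e2 : W₂ * R * W₂.transpose = V₁ * (B * R * B) * V₁.transpose +
        V₁ * (B * R * A) * V₂.transpose + V₂ * (A * R * B) * V₁.transpose +
        V₂ * (A * R * A) * V₂.transpose := by
      simp only [W₂, Matrix.transpose_add, Matrix.transpose_mul, hAt, hBt]
      noncomm_ring
    have e3 : V₂ * V₂.transpose - V₁ * V₁.transpose =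
        W₂ * R * W₂.transpose - W₁ * R * W₁.transpose := by
      rw [e1, e2, hARB, hBRA, hARA]
      noncomm_ring
    rw [e3, hinv, blockSwap, Matrix.fromCols_mul_fromBlocks, Matrix.fromCols_mul_fromBlocks,
      Matrix.transpose_fromCols, Matrix.fromCols_mul_fromRows]
    simp only [Matrix.transpose_add, Matrix.transpose_mul, Matrix.transpose_smul, hRt,
      Matrix.mul_smul, Matrix.smul_mul, mul_one, mul_zero, add_zero,
      zero_add, neg_smul, mul_neg, neg_mul, mul_add, add_mul, mul_assoc, Matrix.transpose_neg]
    module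
  rw [WCondition, key]
  constructor
  · intro h
    have := h.smul (show (0 : ℝ) ≤ 2 by norm_num)
    rwa [smul_smul, mul_inv_cancel₀ (by norm_num), one_smul] at this
  · exact fun h => h.smul (by norm_num)

theorem dotProduct_self_eq_norm_sq (x : Fin d → ℝ) : x ⬝ᵥ x = ‖(WithLp.toLp 2 x : Euc d)‖ ^ 2 := by
  rw [← real_inner_self_eq_norm_sq, EuclideanSpace.inner_toLp_toLp]
  simp

theorem posSemidef_sub_iff (V₁ V₂ : Matrix (Fin d) (Fin d) ℝ) :
    (V₂ * V₂.transpose - V₁ * V₁.transpose).PosSemidef ↔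
      ∀ x : Euc d, ‖act V₁.transpose x‖ ≤ ‖act V₂.transpose x‖ := by
  have hsym : (V₂ * V₂.transpose - V₁ * V₁.transpose).IsHermitian := by
    rw [Matrix.IsHermitian, Matrix.conjTranspose_eq_transpose_of_trivial, Matrix.transpose_sub,
      Matrix.transpose_mul, Matrix.transpose_mul, Matrix.transpose_transpose,
      Matrix.transpose_transpose]
  have e : ∀ (V : Matrix (Fin d) (Fin d) ℝ) (x : Fin d → ℝ), x ⬝ᵥ (V * V.transpose).mulVec x =
      ‖act V.transpose (WithLp.toLp 2 x)‖ ^ 2 := fun V x => by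
    rw [Matrix.toEuclideanCLM_toLp, ← dotProduct_self_eq_norm_sq, ← Matrix.mulVec_mulVec,
      Matrix.dotProduct_mulVec, ← Matrix.mulVec_transpose]
  rw [Matrix.posSemidef_iff_dotProduct_mulVec]
  constructor
  · rintro ⟨-, h⟩ x
    have := h x.ofLp
    rw [star_trivial, Matrix.sub_mulVec, dotProduct_sub, e, e, sub_nonneg] at this
    exact le_of_sq_le_sq this (norm_nonneg _)
  · intro h
    refine ⟨hsym, fun x => ?_⟩
    rw [star_trivial, Matrix.sub_mulVec, dotProduct_sub, e, e, sub_nonneg]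
    gcongr
    exact h _

theorem norm_act_transpose (M : Matrix (Fin d) (Fin d) ℝ) : ‖act M.transpose‖ = ‖act M‖ := by
  rw [act_transpose, ContinuousLinearMap.adjoint.norm_map]

theorem isUnit_of_act_injective {V : Matrix (Fin d) (Fin d) ℝ}
    (h : ∀ x, act V x = 0 → x = 0) : IsUnit V := by
  refine Matrix.mulVec_injective_iff_isUnit.1 fun x y hxy => ?_
  have := h (WithLp.toLp 2 x - WithLp.toLp 2 y) (by
    rw [map_sub, Matrix.toEuclideanCLM_toLp, Matrix.toEuclideanCLM_toLp]
    rw [show V.mulVec x = V.mulVec y from hxy, sub_self])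
  exact WithLp.toLp_injective 2 (sub_eq_zero.1 this)

theorem isUnit_transpose {V : Matrix (Fin d) (Fin d) ℝ} (h : IsUnit V.transpose) : IsUnit V := by
  rw [Matrix.isUnit_iff_isUnit_det, Matrix.det_transpose] at h
  exact (Matrix.isUnit_iff_isUnit_det V).2 h

/-- If `(V₁ V₂) T` has full rank and `V₁ V₁* ≤ V₂ V₂*`, then `V₂` is invertible: the kernel of
`V₂*` is contained in that of `V₁*`, hence in that of `((V₁ V₂) T)*`. -/
theorem isUnit_of_rank_eq {V₁ V₂ A B : Matrix (Fin d) (Fin d) ℝ}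
    (hr : (Matrix.fromCols (V₁ * A + V₂ * B) (V₁ * B + V₂ * A)).rank = d)
    (h : ∀ x : Euc d, ‖act V₁.transpose x‖ ≤ ‖act V₂.transpose x‖) : IsUnit V₂ := by
  refine isUnit_transpose (isUnit_of_act_injective fun x hx => ?_)
  have hx1 : act V₁.transpose x = 0 := by
    have := h x
    rwa [hx, norm_zero, norm_le_zero_iff] at this
  have h1 : Matrix.vecMul x.ofLp V₁ = 0 := by
    rw [← Matrix.mulVec_transpose, ← Matrix.ofLp_toEuclideanCLM (𝕜 := ℝ)]
    exact congrArg WithLp.ofLp hx1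
  have h2 : Matrix.vecMul x.ofLp V₂ = 0 := by
    rw [← Matrix.mulVec_transpose, ← Matrix.ofLp_toEuclideanCLM (𝕜 := ℝ)]
    exact congrArg WithLp.ofLp hx
  have hinj : Function.Injective fun v =>
      Matrix.vecMul v (Matrix.fromCols (V₁ * A + V₂ * B) (V₁ * B + V₂ * A)) := by
    rw [Matrix.vecMul_injective_iff, linearIndependent_iff_card_eq_finrank_span, Set.finrank,
      ← Matrix.rank_eq_finrank_span_row, hr, Fintype.card_fin]
  have h0 : x.ofLp = 0 := hinj (by
    simp only [Matrix.vecMul_fromCols, Matrix.vecMul_add, ← Matrix.vecMul_vecMul, h1, h2,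
      Matrix.zero_vecMul, add_zero]
    ext i
    rcases i with i | i <;> rfl)
  exact WithLp.ofLp_injective 2 h0

theorem rank_fromCols_eq (hP : P.transpose = P) (hu : IsUnit P) (M : Matrix (Fin d) (Fin d) ℝ) :
    (Matrix.fromCols (Qminus P - M * Qplus P) (Qplus P - M * Qminus P)).rank = d := by
  obtain ⟨G, hA, hB, hG⟩ := exists_inverse_abs hP hu
  have hAB := Qplus_mul_Qminus hP
  have hBA := Qminus_mul_Qplus hP
  set A := Qplus P
  set B := Qminus P
  refine le_antisymm (Matrix.rank_le_card_height _ |>.trans_eq (Fintype.card_fin d)) ?_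
  have h1 : Matrix.fromCols (B - M * A) (A - M * B) * Matrix.fromRows (B * G) (A * G) = 1 := by
    have e : (B - M * A) * (B * G) + (A - M * B) * (A * G) =
        A * A * G + B * B * G - M * (A * B) * G - M * (B * A) * G := by noncomm_ring
    rw [Matrix.fromCols_mul_fromRows, e, hAB, hBA, ← hG, mul_add, ← mul_assoc G A, hA.eq,
      ← mul_assoc G B, hB.eq, mul_assoc A G, hA.eq, mul_assoc B G, hB.eq]
    simp [mul_assoc]
  have h2 := Matrix.rank_mul_le_left (Matrix.fromCols (B - M * A) (A - M * B))
    (Matrix.fromRows (B * G) (A * G))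
  rwa [h1, Matrix.rank_one, Fintype.card_fin] at h2

theorem mulVec_eq_zero_iff (V₁ V₂ A B : Matrix (Fin d) (Fin d) ℝ) (p q : Euc d) :
    (Matrix.fromCols (V₁ * A + V₂ * B) (V₁ * B + V₂ * A)).mulVec (Sum.elim p q) = 0 ↔
      act V₁ (act A p + act B q) + act V₂ (act A q + act B p) = 0 := by
  rw [← (WithLp.ofLp_injective 2).eq_iff (a := act V₁ _ + _)]
  have : WithLp.ofLp (act V₁ (act A p + act B q) + act V₂ (act A q + act B p)) =
      (Matrix.fromCols (V₁ * A + V₂ * B) (V₁ * B + V₂ * A)).mulVec (Sum.elim p q) := by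
    rw [Matrix.fromCols_mulVec]
    simp only [WithLp.ofLp_add, Matrix.ofLp_toEuclideanCLM, Sum.elim_comp_inl, Sum.elim_comp_inr,
      Matrix.mulVec_add, Matrix.add_mulVec, Matrix.mulVec_mulVec]
    abel
  rw [this]
  rfl

theorem act_inv_act {V : Matrix (Fin d) (Fin d) ℝ} (hV : IsUnit V) (x : Euc d) :
    act V⁻¹ (act V x) = x := by
  rw [← act_mul, Matrix.nonsing_inv_mul _ ((Matrix.isUnit_iff_isUnit_det V).1 hV), act_one]

theorem act_act_inv {V : Matrix (Fin d) (Fin d) ℝ} (hV : IsUnit V) (x : Euc d) :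
    act V (act V⁻¹ x) = x := by
  rw [← act_mul, Matrix.mul_nonsing_inv _ ((Matrix.isUnit_iff_isUnit_det V).1 hV), act_one]

/-- For invertible `V₂` the boundary condition `V₁ y + V₂ z = 0` reads `z = -V₂⁻¹ V₁ y`. -/
theorem act_add_act_eq_zero_iff {V₁ V₂ : Matrix (Fin d) (Fin d) ℝ} (hV : IsUnit V₂) (y z : Euc d) :
    act V₁ y + act V₂ z = 0 ↔ z = act (-(V₂⁻¹ * V₁)) y := by
  rw [act_neg, act_mul]
  constructor
  · intro h
    rw [eq_neg_of_add_eq_zero_left h, map_neg, act_inv_act hV, neg_neg]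
  · rintro rfl
    rw [map_neg, act_act_inv hV, add_neg_cancel]

end BoundaryMatrices

/-! ### Linear differential equations with bounded measurable coefficients -/

/-- The initial value problem `v' = F + A v`, `v(a) = c`, with an integrable function `F` and a
bounded measurable family of operators `A` has a solution. After the substitution
`v(x) = exp (l (x - a)) w(x)` with large `l` the integral equation is solved by the contraction
principle in the space of continuous functions. -/
theorem exists_isPrimitive_linear {E : Type*} [NormedAddCommGroup E] [NormedSpace ℝ E]
    [CompleteSpace E] {a b : ℝ} (hab : a ≤ b) {A : ℝ → E →L[ℝ] E} {K : ℝ} (hK0 : 0 ≤ K)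
    (hK : ∀ t, ‖A t‖ ≤ K) (hA : AEStronglyMeasurable A (vol a b)) {F : ℝ → E}
    (hF : IntervalIntegrable F volume a b) (c : E) :
    ∃ v : ℝ → E, v a = c ∧ IsPrimitive a b v fun t => F t + A t (v t) := by
  set l : ℝ := 2 * K + 1 with hl
  have hl0 : 0 < l := by positivity
  have hexp : Continuous fun t : ℝ => Real.exp (l * (t - a)) := by fun_prop
  have hint : ∀ w : C(Icc a b, E), IntervalIntegrable
      (fun t => Real.exp (l * (t - a)) • A t (IccExtend hab w t)) volume a b := by
    intro w
    have hw : Continuous (IccExtend hab w) := w.continuous.Icc_extend'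
    refine IntervalIntegrable.continuousOn_smul ?_ hexp.continuousOn
    rw [intervalIntegrable_iff_integrableOn_Ioo_of_le hab]
    refine Integrable.of_bound (C := K * ‖w‖) ?_ (Filter.Eventually.of_forall fun t => ?_)
    · have hm := hA.prodMk (hw.aestronglyMeasurable (μ := vol a b))
      exact (isBoundedBilinearMap_apply (𝕜 := ℝ) (E := E) (F := E)).continuous
        |>.comp_aestronglyMeasurable hm
    · refine ((A t).le_opNorm _).trans ?_
      gcongr
      · exact hK t
      · exact w.norm_coe_le_norm _
  have hsub : ∀ {x}, x ∈ Icc a b → uIcc a x ⊆ uIcc a b := fun {x} hx => by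
    rw [uIcc_of_le hx.1, uIcc_of_le hab]
    exact Icc_subset_Icc_right hx.2
  have hex : ∀ w : C(Icc a b, E), ∃ w' : C(Icc a b, E), ∀ x : Icc a b,
      w' x = Real.exp (-(l * (x - a))) • (c + ∫ t in a..(x : ℝ),
        (F t + Real.exp (l * (t - a)) • A t (IccExtend hab w t))) := by
    intro w
    have hp : IsPrimitive a b (fun x => c + ∫ t in a..x,
        (F t + Real.exp (l * (t - a)) • A t (IccExtend hab w t))) _ :=
      ⟨hF.add (hint w), fun x _ => by simp⟩
    have hc := continuousOn_iff_continuous_domRestrict.1 (hp.continuousOn hab)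
    exact ⟨⟨fun x => Real.exp (-(l * (x - a))) • (c + ∫ t in a..(x : ℝ),
      (F t + Real.exp (l * (t - a)) • A t (IccExtend hab w t))),
      (by fun_prop : Continuous fun x : Icc a b => Real.exp (-(l * ((x : ℝ) - a)))).smul hc⟩,
      fun x => rfl⟩
  choose Φ hΦ using hex
  have hcontr : ContractingWith (1 / 2) Φ := by
    refine ⟨by rw [← NNReal.coe_lt_coe]; norm_num, LipschitzWith.of_dist_le_mul fun w₁ w₂ => ?_⟩
    rw [ContinuousMap.dist_le (by positivity)]
    intro x
    have hx := x.2
    have hD : 0 ≤ dist w₁ w₂ := dist_nonneg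
    have hi₁ := (hint w₁).mono_set (hsub hx)
    have hi₂ := (hint w₂).mono_set (hsub hx)
    have hFx := hF.mono_set (hsub hx)
    have hle : ‖∫ t in a..(x : ℝ), (Real.exp (l * (t - a)) • A t (IccExtend hab w₁ t) -
        Real.exp (l * (t - a)) • A t (IccExtend hab w₂ t))‖ ≤
        ∫ t in a..(x : ℝ), Real.exp (l * (t - a)) * (K * dist w₁ w₂) := by
      refine intervalIntegral.norm_integral_le_of_norm_le hx.1
        (Filter.Eventually.of_forall fun t _ => ?_)
        ((hexp.mul continuous_const).intervalIntegrable _ _)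
      rw [← smul_sub, ← map_sub, norm_smul, Real.norm_eq_abs, Real.abs_exp]
      gcongr
      refine ((A t).le_opNorm _).trans ?_
      gcongr
      · exact hK t
      · rw [← dist_eq_norm]
        exact ContinuousMap.dist_apply_le_dist _
    have hval : ∫ t in a..(x : ℝ), Real.exp (l * (t - a)) * (K * dist w₁ w₂) =
        Real.exp (l * (x - a)) / l * (K * dist w₁ w₂) -
          Real.exp (l * (a - a)) / l * (K * dist w₁ w₂) := by
      refine intervalIntegral.integral_eq_sub_of_hasDerivAt
        (f := fun t => Real.exp (l * (t - a)) / l * (K * dist w₁ w₂)) (fun t _ => ?_)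
        ((hexp.mul continuous_const).intervalIntegrable _ _)
      have h1 : HasDerivAt (fun t : ℝ => l * (t - a)) l t := by
        simpa using ((hasDerivAt_id t).sub_const a).const_mul l
      have h2 := ((h1.exp.div_const l).mul_const (K * dist w₁ w₂))
      rwa [mul_div_assoc, div_self hl0.ne', mul_one] at h2
    rw [dist_eq_norm, hΦ, hΦ, ← smul_sub, add_sub_add_left_eq_sub,
      ← intervalIntegral.integral_sub (hFx.add hi₁) (hFx.add hi₂)]
    simp only [add_sub_add_left_eq_sub]
    rw [norm_smul, Real.norm_eq_abs, Real.abs_exp]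
    have h3 : Real.exp (-(l * (x - a))) * Real.exp (l * (x - a)) = 1 := by
      rw [← Real.exp_add, neg_add_cancel, Real.exp_zero]
    calc Real.exp (-(l * (x - a))) * _
        ≤ Real.exp (-(l * (x - a))) * (Real.exp (l * (x - a)) / l * (K * dist w₁ w₂) -
          Real.exp (l * (a - a)) / l * (K * dist w₁ w₂)) := by
          gcongr
          exact hle.trans_eq hval
      _ ≤ Real.exp (-(l * (x - a))) * (Real.exp (l * (x - a)) / l * (K * dist w₁ w₂)) := by
          gcongr
          have : 0 ≤ Real.exp (l * (a - a)) / l * (K * dist w₁ w₂) := by positivity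
          linarith
      _ = (Real.exp (-(l * (x - a))) * Real.exp (l * (x - a))) * (K / l) * dist w₁ w₂ := by ring
      _ ≤ (1 / 2 : NNReal) * dist w₁ w₂ := by
          rw [h3, one_mul]
          gcongr
          rw [div_le_iff₀ hl0, hl]
          push_cast
          linarith
  have : Nonempty C(Icc a b, E) := ⟨0⟩
  set w := hcontr.fixedPoint Φ
  have hw : Φ w = w := hcontr.fixedPoint_isFixedPt
  have hwx : ∀ x ∈ Icc a b, Real.exp (l * (x - a)) • IccExtend hab w x = c + ∫ t in a..x,
      (F t + A t (Real.exp (l * (t - a)) • IccExtend hab w t)) := by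
    intro x hx
    have h := hΦ w ⟨x, hx⟩
    rw [hw] at h
    simp only [map_smul]
    rw [IccExtend_of_mem hab _ hx, h, smul_smul, ← Real.exp_add, add_neg_cancel, Real.exp_zero,
      one_smul]
  refine ⟨fun x => Real.exp (l * (x - a)) • IccExtend hab w x, ?_, ?_, fun x hx => ?_⟩
  · simp only
    rw [hwx a (left_mem_Icc.2 hab), intervalIntegral.integral_same, add_zero]
  · have := hF.add (hint w)
    simpa only [map_smul] using this
  · simp only
    rw [hwx x hx, hwx a (left_mem_Icc.2 hab), intervalIntegral.integral_same, add_zero]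

/-! ### The pointwise inverse of the density -/

theorem IsDensity.exists_le_inner {d : ℕ} {a b : ℝ} {ℋ : ℝ → Matrix (Fin d) (Fin d) ℝ}
    (hℋ : IsDensity a b ℋ) :
    ∃ m : ℝ, 0 < m ∧ ∀ t ∈ Ioo a b, ∀ x : Euc d, m * ‖x‖ ^ 2 ≤ ⟪act (ℋ t) x, x⟫_ℝ := by
  obtain ⟨m, M, hm, -, h⟩ := hℋ.bounds
  refine ⟨m, hm, fun t ht x => ?_⟩
  have h1 := (h t ht).1.dotProduct_mulVec_nonneg x.ofLp
  rw [star_trivial, ← Matrix.inner_toEuclideanCLM, map_sub, map_smul, map_one] at h1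
  simp only [_root_.sub_apply, _root_.smul_apply, inner_sub_right,
    real_inner_smul_right, one_apply_eq_self, real_inner_self_eq_norm_sq] at h1
  rw [real_inner_comm]
  linarith

theorem measurable_det {d : ℕ} {X : Type*} [MeasurableSpace X]
    {A : X → Matrix (Fin d) (Fin d) ℝ} (hA : ∀ i j, Measurable fun x => A x i j) :
    Measurable fun x => (A x).det := by
  simp only [Matrix.det_apply]
  exact Finset.measurable_sum _ fun σ _ =>
    (Finset.measurable_prod _ fun i _ => hA _ _).const_smul _

theorem measurable_inv_apply {d : ℕ} {X : Type*} [MeasurableSpace X]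
    {A : X → Matrix (Fin d) (Fin d) ℝ} (hA : ∀ i j, Measurable fun x => A x i j) (i j : Fin d) :
    Measurable fun x => (A x)⁻¹ i j := by
  simp only [Matrix.inv_def, Matrix.smul_apply, Ring.inverse_eq_inv', Matrix.adjugate_apply,
    smul_eq_mul]
  refine (measurable_det hA).inv.mul (measurable_det fun k l => ?_)
  simp only [Matrix.updateRow_apply]
  split_ifs
  · exact measurable_const
  · exact hA k l

theorem act_eq_sum {d : ℕ} (A : Matrix (Fin d) (Fin d) ℝ) :
    act A = ∑ i, ∑ j, A i j • act (Matrix.single i j 1) := by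
  conv_lhs => rw [Matrix.matrix_eq_sum_single A]
  simp only [act, map_sum, ← map_smul, Matrix.smul_single, smul_eq_mul, mul_one]

/-- The pointwise inverse of `ℋ` is a bounded measurable family of operators. -/
theorem IsDensity.exists_inverse {d : ℕ} {a b : ℝ} {ℋ : ℝ → Matrix (Fin d) (Fin d) ℝ}
    (hℋ : IsDensity a b ℋ) :
    ∃ (S : ℝ → Euc d →L[ℝ] Euc d) (C : ℝ), 0 ≤ C ∧ (∀ t, ‖S t‖ ≤ C) ∧
      AEStronglyMeasurable S (vol a b) ∧ ∀ t ∈ Ioo a b, ∀ x, act (ℋ t) (S t x) = x := by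
  obtain ⟨m, hm, hle⟩ := hℋ.exists_le_inner
  have hunit : ∀ t ∈ Ioo a b, IsUnit (ℋ t) := fun t ht =>
    isUnit_of_act_injective fun x hx => by
      have := hle t ht x
      rw [hx, inner_zero_left] at this
      have h0 : ‖x‖ ^ 2 ≤ 0 := by nlinarith [sq_nonneg ‖x‖]
      exact norm_eq_zero.1 (pow_eq_zero_iff two_ne_zero |>.1 (le_antisymm h0 (sq_nonneg _)))
  have hr : ∀ t ∈ Ioo a b, ∀ x, act (ℋ t) (act (ℋ t)⁻¹ x) = x := fun t ht x =>
    act_act_inv (hunit t ht) x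
  classical
  refine ⟨fun t => if t ∈ Ioo a b then act (ℋ t)⁻¹ else 0, m⁻¹, by positivity, fun t => ?_, ?_,
    fun t ht x => ?_⟩
  · beta_reduce
    split_ifs with ht
    · refine ContinuousLinearMap.opNorm_le_bound _ (by positivity) fun x => ?_
      have h1 := hle t ht (act (ℋ t)⁻¹ x)
      rw [hr t ht] at h1
      have h2 := real_inner_le_norm x (act (ℋ t)⁻¹ x)
      rcases (norm_nonneg (act (ℋ t)⁻¹ x)).eq_or_lt with h | h
      · rw [← h]
        positivity
      · rw [inv_mul_eq_div, le_div_iff₀ hm]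
        exact le_of_mul_le_mul_right (by linarith) h
    · rw [norm_zero]
      positivity
  · have heq : (fun t => if t ∈ Ioo a b then act (ℋ t)⁻¹ else 0) = fun t => ∑ i, ∑ j,
        Function.extend Subtype.val (fun x : Ioo a b => (ℋ x)⁻¹ i j) 0 t •
          act (Matrix.single i j 1) := by
      funext t
      split_ifs with ht
      · have he : ∀ i j, Function.extend Subtype.val (fun x : Ioo a b => (ℋ x)⁻¹ i j) 0 t =
            (ℋ t)⁻¹ i j := fun i j =>
          Subtype.val_injective.extend_apply (fun x : Ioo a b => (ℋ x)⁻¹ i j) 0 ⟨t, ht⟩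
        simp only [he]
        exact act_eq_sum _
      · have he : ∀ i j, Function.extend Subtype.val (fun x : Ioo a b => (ℋ x)⁻¹ i j) 0 t = 0 :=
          fun i j => Function.extend_apply' _ _ _ fun ⟨x, hx⟩ => ht (hx ▸ x.2)
        simp only [he]
        exact (Finset.sum_eq_zero fun i _ => Finset.sum_eq_zero fun j _ =>
          zero_smul ℝ (act (Matrix.single i j 1))).symm
    rw [heq]
    refine Finset.aestronglyMeasurable_fun_sum _ fun i _ =>
      Finset.aestronglyMeasurable_fun_sum _ fun j _ => ?_
    exact (((MeasurableEmbedding.subtype_coe measurableSet_Ioo).measurable_extend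
      (measurable_inv_apply hℋ.measurable i j) measurable_zero).aestronglyMeasurable).smul_const _
  · beta_reduce
    rw [if_pos ht]
    exact hr t ht x

/-! ### Boundary values -/

section Trace

variable {d : ℕ} {a b : ℝ} {ℋ : ℝ → Matrix (Fin d) (Fin d) ℝ}

/-- The maximal domain, which consists of all `u` with `ℋu` in `H¹(a, b)^d`. -/
def maxDom (d : ℕ) (a b : ℝ) (ℋ : ℝ → Matrix (Fin d) (Fin d) ℝ) : Submodule ℝ (L2 d a b) where
  carrier := {u | MemH1 a b (mulH ℋ u)}
  zero_mem' := by
    obtain ⟨g, hg, -⟩ := (maxGraph a b 0 0 ℋ).zero_mem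
    exact ⟨g, hg⟩
  add_mem' := by
    rintro u v ⟨g, hg⟩ ⟨k, hk⟩
    exact ⟨g + k, (hg.add hk).congr (mulH_add ℋ u v).symm (Filter.EventuallyEq.refl _ _)⟩
  smul_mem' := by
    rintro c u ⟨g, hg⟩
    exact ⟨c • g, (hg.const_smul c).congr (mulH_smul ℋ c u).symm (Filter.EventuallyEq.refl _ _)⟩

theorem MemH1.contRep_spec (hab : a < b) {f : ℝ → Euc d} (hf : MemH1 a b f) :
    ContinuousOn (contRep a b f) (Icc a b) ∧ f =ᵐ[vol a b] contRep a b f := by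
  obtain ⟨g, hg⟩ := hf
  obtain ⟨v, hv, hfv⟩ := hg.exists_isPrimitive hab
  have hvc := hv.continuousOn hab.le
  have he := contRep_eqOn hab hvc hfv
  refine ⟨hvc.congr he, ?_⟩
  filter_upwards [hfv, ae_restrict_mem measurableSet_Ioo] with x h1 h2
  rw [h1, he (Ioo_subset_Icc_self h2)]

theorem contRep_mulH_add (hab : a < b) {u v : L2 d a b} (hu : MemH1 a b (mulH ℋ u))
    (hv : MemH1 a b (mulH ℋ v)) {x : ℝ} (hx : x ∈ Icc a b) :
    contRep a b (mulH ℋ (u + v)) x = contRep a b (mulH ℋ u) x + contRep a b (mulH ℋ v) x := by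
  obtain ⟨h1, h2⟩ := hu.contRep_spec hab
  obtain ⟨h3, h4⟩ := hv.contRep_spec hab
  exact contRep_eqOn hab (h1.add h3) ((mulH_add ℋ u v).trans (h2.add h4)) hx

theorem contRep_mulH_smul (hab : a < b) {u : L2 d a b} (hu : MemH1 a b (mulH ℋ u)) (c : ℝ)
    {x : ℝ} (hx : x ∈ Icc a b) :
    contRep a b (mulH ℋ (c • u)) x = c • contRep a b (mulH ℋ u) x := by
  obtain ⟨h1, h2⟩ := hu.contRep_spec hab
  exact contRep_eqOn hab (h1.const_smul c) ((mulH_smul ℋ c u).trans (h2.const_smul c)) hx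

/-- The value of `ℋu` at the point `x` of `[a, b]`, as a linear function of `u`. -/
def pointValue (hab : a < b) (ℋ : ℝ → Matrix (Fin d) (Fin d) ℝ) {x : ℝ} (hx : x ∈ Icc a b) :
    maxDom d a b ℋ →ₗ[ℝ] Euc d where
  toFun u := contRep a b (mulH ℋ (u : L2 d a b)) x
  map_add' u v := contRep_mulH_add hab u.2 v.2 hx
  map_smul' c u := contRep_mulH_smul hab u.2 c hx

/-- The boundary value `y = Q₊ (ℋu)(b) + Q₋ (ℋu)(a)`, as a linear function of `u`. -/
def bdryOutL (hab : a < b) (ℋ : ℝ → Matrix (Fin d) (Fin d) ℝ) (P : Matrix (Fin d) (Fin d) ℝ) :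
    maxDom d a b ℋ →ₗ[ℝ] Euc d :=
  (act (Qplus P) : Euc d →ₗ[ℝ] Euc d) ∘ₗ pointValue hab ℋ (right_mem_Icc.2 hab.le) +
    (act (Qminus P) : Euc d →ₗ[ℝ] Euc d) ∘ₗ pointValue hab ℋ (left_mem_Icc.2 hab.le)

/-- The boundary value `z = Q₊ (ℋu)(a) + Q₋ (ℋu)(b)`, as a linear function of `u`. -/
def bdryInL (hab : a < b) (ℋ : ℝ → Matrix (Fin d) (Fin d) ℝ) (P : Matrix (Fin d) (Fin d) ℝ) :
    maxDom d a b ℋ →ₗ[ℝ] Euc d :=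
  (act (Qplus P) : Euc d →ₗ[ℝ] Euc d) ∘ₗ pointValue hab ℋ (left_mem_Icc.2 hab.le) +
    (act (Qminus P) : Euc d →ₗ[ℝ] Euc d) ∘ₗ pointValue hab ℋ (right_mem_Icc.2 hab.le)

/-- Division by `ℋ`: if `S` is the pointwise inverse of `ℋ`, then `u = S v` has `ℋu = v`. -/
theorem exists_mulH_eq {S : ℝ → Euc d →L[ℝ] Euc d} {C : ℝ} (hS : ∀ t, ‖S t‖ ≤ C)
    (hSm : AEStronglyMeasurable S (vol a b)) (hinv : ∀ t ∈ Ioo a b, ∀ x, act (ℋ t) (S t x) = x)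
    {v : ℝ → Euc d} (hv : MemLp v 2 (vol a b)) :
    ∃ u : L2 d a b, u =ᵐ[vol a b] (fun t => S t (v t)) ∧ mulH ℋ u =ᵐ[vol a b] v := by
  have hm : MemLp (fun t => S t (v t)) 2 (vol a b) := by
    refine hv.of_le_mul (c := C) ?_ (Filter.Eventually.of_forall fun t =>
      (S t).le_of_opNorm_le (hS t) _)
    exact (isBoundedBilinearMap_apply (𝕜 := ℝ) (E := Euc d) (F := Euc d)).continuous
      |>.comp_aestronglyMeasurable (hSm.prodMk hv.1)
  refine ⟨hm.toLp _, hm.coeFn_toLp, ?_⟩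
  filter_upwards [hm.coeFn_toLp, ae_restrict_mem measurableSet_Ioo] with x h1 h2
  rw [mulH, h1, hinv x h2]

/-- The boundary values of `ℋu` can be prescribed arbitrarily. -/
theorem exists_boundary_values (hab : a < b) (hℋ : IsDensity a b ℋ) (p q : Euc d) :
    ∃ u : L2 d a b, MemH1 a b (mulH ℋ u) ∧ contRep a b (mulH ℋ u) b = p ∧
      contRep a b (mulH ℋ u) a = q := by
  obtain ⟨S, C, -, hS, hSm, hinv⟩ := hℋ.exists_inverse
  set v : ℝ → Euc d := fun x => q + ((x - a) / (b - a)) • (p - q) with hv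
  have hvc : ContDiff ℝ ∞ v := by fun_prop
  have hvp := IsPrimitive.of_contDiff a b hvc
  have hvh := hvp.hasH1Deriv hab.le
    (memLp_of_continuousOn (hvc.continuous_deriv (by simp)).continuousOn)
  obtain ⟨u, -, hu⟩ := exists_mulH_eq hS hSm hinv hvh.memLp
  have he := contRep_eqOn hab hvc.continuous.continuousOn hu
  refine ⟨u, ⟨_, hvh.congr hu.symm (Filter.EventuallyEq.refl _ _)⟩, ?_, ?_⟩
  · rw [he (right_mem_Icc.2 hab.le), hv]
    simp [div_self (sub_pos.2 hab).ne']
  · rw [he (left_mem_Icc.2 hab.le), hv]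
    simp

theorem exists_bdryOut_bdryIn (hab : a < b) (hℋ : IsDensity a b ℋ)
    {P : Matrix (Fin d) (Fin d) ℝ} (hP : P.transpose = P) (hu : IsUnit P) (y z : Euc d) :
    ∃ u : L2 d a b, MemH1 a b (mulH ℋ u) ∧ bdryOut P ℋ u = y ∧ bdryIn P ℋ u = z := by
  obtain ⟨p, q, h1, h2⟩ := exists_act_eq hP hu y z
  obtain ⟨u, hu, hb, ha⟩ := exists_boundary_values hab hℋ p q
  exact ⟨u, hu, by rw [bdryOut, hb, ha, h1], by rw [bdryIn, hb, ha, h2]⟩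

end Trace

/-! ### The energy identity -/

section Energy

variable {d : ℕ} {a b : ℝ} {ℋ : ℝ → Matrix (Fin d) (Fin d) ℝ} {P₁ P₀ : Matrix (Fin d) (Fin d) ℝ}

theorem inner_act_sub_inner_act {P : Matrix (Fin d) (Fin d) ℝ} (hP : P.transpose = P)
    (hu : IsUnit P) (p q : Euc d) :
    ⟪act P p, p⟫_ℝ - ⟪act P q, q⟫_ℝ =
      ‖act (Qplus P) p + act (Qminus P) q‖ ^ 2 - ‖act (Qplus P) q + act (Qminus P) p‖ ^ 2 := by
  have horth : ∀ x y : Euc d, ⟪act (Qplus P) x, act (Qminus P) y⟫_ℝ = 0 := fun x y => by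
    rw [inner_act_left, transpose_Qplus hP, ← act_mul, Qplus_mul_Qminus hP]
    simp
  have hsq : ∀ x, ⟪act P x, x⟫_ℝ = ‖act (Qplus P) x‖ ^ 2 - ‖act (Qminus P) x‖ ^ 2 := fun x => by
    conv_lhs => rw [← Qplus_sq_sub_Qminus_sq hP hu]
    rw [act_sub, inner_sub_left, act_mul, act_mul, inner_act_left (Qplus P),
      inner_act_left (Qminus P), transpose_Qplus hP, transpose_Qminus hP, real_inner_self_eq_norm_sq,
      real_inner_self_eq_norm_sq]
  rw [hsq, hsq, norm_add_sq_real, norm_add_sq_real, horth, horth]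
  ring

/-- The energy identity `⟨𝒜u, u⟩_H = (‖y‖² - ‖z‖²) / 2`. -/
theorem innerH_eq (hab : a < b) (hP₁ : P₁.transpose = P₁) (hu : IsUnit P₁)
    (hP₀ : P₀.transpose = -P₀) (hℋ : IsDensity a b ℋ) {u w : L2 d a b}
    (h : (u, w) ∈ maxGraph a b P₁ P₀ ℋ) :
    innerH ℋ w u = 1 / 2 * (‖bdryOut P₁ ℋ u‖ ^ 2 - ‖bdryIn P₁ ℋ u‖ ^ 2) := by
  obtain ⟨g, hg, hw⟩ := h
  simp only at hg hw
  obtain ⟨v, hv, huv⟩ := hg.exists_isPrimitive hab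
  have he := contRep_eqOn hab (hv.continuousOn hab.le) huv
  rw [bdryOut, bdryIn, he (right_mem_Icc.2 hab.le), he (left_mem_Icc.2 hab.le),
    ← inner_act_sub_inner_act hP₁ hu, ← (hv.comp_clm (act P₁)).integral_inner hab.le hv,
    ← setIntegral_eq_intervalIntegral hab.le, ← integral_const_mul, innerH]
  refine integral_congr_ae ?_
  filter_upwards [hw, huv, ae_restrict_mem measurableSet_Ioo] with x h1 h2 h3
  have h4 : ⟪act P₀ (v x), v x⟫_ℝ = 0 := by
    have h5 := inner_act_left P₀ (v x) (v x)
    rw [hP₀, act_neg, inner_neg_right, real_inner_comm (act P₀ (v x))] at h5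
    linarith
  have h6 : ⟪act P₁ (v x), g x⟫_ℝ = ⟪act P₁ (g x), v x⟫_ℝ := by
    rw [inner_act_left, hP₁, real_inner_comm]
  rw [mulH, inner_act_left, hℋ.symm x h3, ← mulH, h1, h2, inner_add_left, h4, h6]
  ring

/-- If `u + 𝒜u = 0` and `⟨𝒜u, u⟩_H ≥ 0`, then `u = 0`. -/
theorem eq_zero_of_add_eq_zero (hℋ : IsDensity a b ℋ) {u w : L2 d a b}
    (hu : MemH1 a b (mulH ℋ u)) (h0 : u + w = 0) (hn : 0 ≤ innerH ℋ w u) : u = 0 := by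
  obtain ⟨m, hm, hle⟩ := hℋ.exists_le_inner
  obtain ⟨g, hg⟩ := hu
  obtain rfl : w = -u := eq_neg_of_add_eq_zero_right h0
  have hnonneg : 0 ≤ᵐ[vol a b] fun x => ⟪mulH ℋ u x, u x⟫_ℝ := by
    filter_upwards [ae_restrict_mem measurableSet_Ioo] with x hx
    exact le_trans (by positivity) (hle x hx (u x))
  have hint : Integrable (fun x => ⟪mulH ℋ u x, u x⟫_ℝ) (vol a b) :=
    (L2.integrable_inner (𝕜 := ℝ) (hg.memLp.toLp _) u).congr (by
      filter_upwards [hg.memLp.coeFn_toLp] with x hx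
      rw [hx])
  have hneg : innerH ℋ (-u) u = -∫ x in Ioo a b, ⟪mulH ℋ u x, u x⟫_ℝ := by
    rw [innerH, ← integral_neg]
    refine integral_congr_ae ?_
    filter_upwards [Lp.coeFn_neg u] with x hx
    rw [mulH, hx, Pi.neg_apply, map_neg, inner_neg_left, mulH]
  have hz : ∫ x in Ioo a b, ⟪mulH ℋ u x, u x⟫_ℝ = 0 :=
    le_antisymm (by linarith) (integral_nonneg_of_ae hnonneg)
  have hae := (integral_eq_zero_iff_of_nonneg_ae hnonneg hint).1 hz
  refine Lp.ext ?_
  filter_upwards [hae, Lp.coeFn_zero (Euc d) 2 (vol a b), ae_restrict_mem measurableSet_Ioo]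
    with x h1 h2 h3
  have h4 := hle x h3 (u x)
  rw [show ⟪act (ℋ x) (u x), u x⟫_ℝ = 0 from h1] at h4
  have h5 : ‖u x‖ ^ 2 ≤ 0 := by nlinarith [sq_nonneg ‖u x‖]
  rw [h2, Pi.zero_apply]
  exact norm_eq_zero.1 (pow_eq_zero_iff two_ne_zero |>.1 (le_antisymm h5 (sq_nonneg _)))

theorem exists_mem_maxGraph (P₁ P₀ : Matrix (Fin d) (Fin d) ℝ) {u : L2 d a b}
    (hu : MemH1 a b (mulH ℋ u)) : ∃ w, (u, w) ∈ maxGraph a b P₁ P₀ ℋ := by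
  obtain ⟨g, hg⟩ := hu
  have h1 : MemLp (fun x => act P₁ (g x) + act P₀ (mulH ℋ u x)) 2 (vol a b) :=
    ((act P₁).comp_memLp' hg.memLp_deriv).add ((act P₀).comp_memLp' hg.memLp)
  exact ⟨h1.toLp _, g, hg, h1.coeFn_toLp⟩

theorem memH1_of_mem_maxGraph {u w : L2 d a b} (h : (u, w) ∈ maxGraph a b P₁ P₀ ℋ) :
    MemH1 a b (mulH ℋ u) := by
  obtain ⟨g, hg, -⟩ := h
  exact ⟨g, hg⟩

end Energy

/-! ### Surjectivity of `1 + 𝒜` -/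

section Range

variable {d : ℕ} {a b : ℝ} {ℋ : ℝ → Matrix (Fin d) (Fin d) ℝ} {P₁ P₀ : Matrix (Fin d) (Fin d) ℝ}

/-- The equation `u + P₁ (ℋu)' + P₀ ℋu = f` has a solution with prescribed `(ℋu)(a)`: it is the
linear differential equation `v' = P₁⁻¹ (f - P₀ v - ℋ⁻¹ v)` for `v = ℋu`. -/
theorem exists_solution (hab : a < b) (hu : IsUnit P₁) (P₀ : Matrix (Fin d) (Fin d) ℝ)
    (hℋ : IsDensity a b ℋ) (f : L2 d a b) (c : Euc d) :
    ∃ u : L2 d a b, (u, f - u) ∈ maxGraph a b P₁ P₀ ℋ ∧ contRep a b (mulH ℋ u) a = c := by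
  obtain ⟨S, C, hC, hS, hSm, hinv⟩ := hℋ.exists_inverse
  set R := act P₁⁻¹
  have hRf : MemLp (fun t => R (f t)) 2 (vol a b) := R.comp_memLp' (Lp.memLp f)
  obtain ⟨v, hva, hv⟩ := exists_isPrimitive_linear hab.le
    (A := fun t => -(R ∘L (act P₀ + S t))) (K := ‖R‖ * (‖act P₀‖ + C)) (by positivity)
    (fun t => by
      rw [norm_neg]
      refine (R.opNorm_comp_le _).trans ?_
      gcongr
      exact (norm_add_le _ _).trans (by gcongr; exact hS t))
    (((ContinuousLinearMap.compL ℝ (Euc d) (Euc d) (Euc d) R).continuous.comp_aestronglyMeasurable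
      (aestronglyMeasurable_const.add hSm)).neg)
    (intervalIntegrable_of_memLp hab.le hRf) c
  have hvc := hv.continuousOn hab.le
  obtain ⟨u, hu1, hu2⟩ := exists_mulH_eq hS hSm hinv (memLp_of_continuousOn hvc)
  have hg : MemLp (fun t => R (f t) + (-(R ∘L (act P₀ + S t))) (v t)) 2 (vol a b) := by
    have h1 : MemLp (fun t => R (f t) - R (act P₀ (v t) + u t)) 2 (vol a b) :=
      hRf.sub (R.comp_memLp' (((act P₀).comp_memLp' (memLp_of_continuousOn hvc)).add (Lp.memLp u)))
    refine h1.ae_eq ?_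
    filter_upwards [hu1] with t ht
    rw [ht]
    simp [sub_eq_add_neg]
  refine ⟨u, ⟨_, (hv.hasH1Deriv hab.le hg).congr hu2.symm (Filter.EventuallyEq.refl _ _), ?_⟩, ?_⟩
  · filter_upwards [hu1, hu2, Lp.coeFn_sub f u] with t h1 h2 h3
    simp only
    rw [h3, h2, Pi.sub_apply, map_add, act_act_inv hu, _root_.neg_apply,
      ContinuousLinearMap.comp_apply, map_neg, act_act_inv hu, _root_.add_apply, h1]
    abel
  · rw [contRep_eqOn hab hvc hu2 (left_mem_Icc.2 hab.le), hva]

/-- Two linear maps into the same finite-dimensional space: if one is onto and the other one-to-one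
on a subspace, then the latter is onto as well. -/
theorem exists_mem_eq_of_surjOn_of_injOn {X E : Type*} [AddCommGroup X] [Module ℝ X]
    [AddCommGroup E] [Module ℝ E] [FiniteDimensional ℝ E] (β τ : X →ₗ[ℝ] E) (Z : Submodule ℝ X)
    (hτ : ∀ c, ∃ u ∈ Z, τ u = c) (hβ : ∀ u ∈ Z, β u = 0 → u = 0) (c : E) :
    ∃ u ∈ Z, β u = c := by
  have h1 : Function.Injective (β ∘ₗ Z.subtype) := by
    rw [← LinearMap.ker_eq_bot, LinearMap.ker_eq_bot']
    exact fun u hu => Subtype.ext (hβ u u.2 hu)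
  have h2 : Function.Surjective (τ ∘ₗ Z.subtype) := fun c => by
    obtain ⟨u, hu, h⟩ := hτ c
    exact ⟨⟨u, hu⟩, h⟩
  have : FiniteDimensional ℝ Z := FiniteDimensional.of_injective _ h1
  have hdim : Module.finrank ℝ Z = Module.finrank ℝ E :=
    le_antisymm (LinearMap.finrank_le_finrank_of_injective h1)
      (LinearMap.finrank_le_finrank_of_surjective h2)
  obtain ⟨u, hu⟩ := (LinearMap.injective_iff_surjective_of_finrank_eq_finrank hdim).1 h1 c
  exact ⟨u, u.2, hu⟩

/-- The solutions of `u + P₁ (ℋu)' + P₀ ℋu = 0`. -/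
def homogeneousSolutions (a b : ℝ) (P₁ P₀ : Matrix (Fin d) (Fin d) ℝ)
    (ℋ : ℝ → Matrix (Fin d) (Fin d) ℝ) : Submodule ℝ (maxDom d a b ℋ) where
  carrier := {u | ((u : L2 d a b), -(u : L2 d a b)) ∈ maxGraph a b P₁ P₀ ℋ}
  zero_mem' := by
    have := (maxGraph a b P₁ P₀ ℋ).zero_mem
    rwa [mem_ofPred_eq, ZeroMemClass.coe_zero, neg_zero]
  add_mem' := by
    intro u v hu hv
    have := (maxGraph a b P₁ P₀ ℋ).add_mem hu hv
    rwa [Prod.mk_add_mk, ← neg_add] at this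
  smul_mem' := by
    intro c u hu
    have := (maxGraph a b P₁ P₀ ℋ).smul_mem c hu
    rwa [Prod.smul_mk, smul_neg] at this

/-- The defect `z - M y` in the boundary condition, as a linear function of `u`. -/
def bdryDefect (hab : a < b) (ℋ : ℝ → Matrix (Fin d) (Fin d) ℝ) (P M : Matrix (Fin d) (Fin d) ℝ) :
    maxDom d a b ℋ →ₗ[ℝ] Euc d :=
  bdryInL hab ℋ P - (act M : Euc d →ₗ[ℝ] Euc d) ∘ₗ bdryOutL hab ℋ P

theorem bdryDefect_eq_zero_iff (hab : a < b) (P M : Matrix (Fin d) (Fin d) ℝ)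
    (u : maxDom d a b ℋ) : bdryDefect hab ℋ P M u = 0 ↔ (u : L2 d a b) ∈ domM a b P ℋ M := by
  have h : bdryDefect hab ℋ P M u =
      bdryIn P ℋ (u : L2 d a b) - act M (bdryOut P ℋ (u : L2 d a b)) := rfl
  rw [h, sub_eq_zero]
  exact ⟨fun h => ⟨u.2, h⟩, fun h => h.2⟩

theorem norm_act_le {M : Matrix (Fin d) (Fin d) ℝ} (hM : ‖act M‖ ≤ 1) (x : Euc d) :
    ‖act M x‖ ≤ ‖x‖ := by
  simpa using (act M).le_of_opNorm_le hM x

/-- The operator with domain `domM` is accretive for a contraction `M`. -/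
theorem innerH_nonneg_of_mem_domM (hab : a < b) (hP₁ : P₁.transpose = P₁) (hu : IsUnit P₁)
    (hP₀ : P₀.transpose = -P₀) (hℋ : IsDensity a b ℋ) {M : Matrix (Fin d) (Fin d) ℝ}
    (hM : ‖act M‖ ≤ 1) {u w : L2 d a b} (h : (u, w) ∈ maxGraph a b P₁ P₀ ℋ)
    (hd : u ∈ domM a b P₁ ℋ M) : 0 ≤ innerH ℋ w u := by
  rw [innerH_eq hab hP₁ hu hP₀ hℋ h, hd.2]
  have : ‖act M (bdryOut P₁ ℋ u)‖ ^ 2 ≤ ‖bdryOut P₁ ℋ u‖ ^ 2 := by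
    gcongr
    exact norm_act_le hM _
  linarith

/-- For a contraction `M`, the operator `1 + 𝒜` with domain `domM` is onto. On the space of
all solutions of `u + 𝒜u = 0` without boundary condition, the map `u ↦ z - M y` is injective, by
the energy identity; since this space has dimension at least `d`, the map is onto, so that the
boundary defect of a particular solution can be corrected. -/
theorem exists_mem_domM (hab : a < b) (hP₁ : P₁.transpose = P₁) (hu : IsUnit P₁)
    (hP₀ : P₀.transpose = -P₀) (hℋ : IsDensity a b ℋ) {M : Matrix (Fin d) (Fin d) ℝ}
    (hM : ‖act M‖ ≤ 1) (f : L2 d a b) :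
    ∃ u w : L2 d a b, (u, w) ∈ maxGraph a b P₁ P₀ ℋ ∧ u ∈ domM a b P₁ ℋ M ∧ u + w = f := by
  have hβ := exists_mem_eq_of_surjOn_of_injOn (bdryDefect hab ℋ P₁ M)
    (pointValue hab ℋ (left_mem_Icc.2 hab.le)) (homogeneousSolutions a b P₁ P₀ ℋ)
    (fun c => by
      obtain ⟨u, h1, h2⟩ := exists_solution hab hu P₀ hℋ 0 c
      rw [zero_sub] at h1
      exact ⟨⟨u, memH1_of_mem_maxGraph h1⟩, h1, h2⟩)
    (fun u hu2 h0 => Subtype.ext (eq_zero_of_add_eq_zero hℋ u.2 (add_neg_cancel _)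
      (innerH_nonneg_of_mem_domM hab hP₁ hu hP₀ hℋ hM hu2
        ((bdryDefect_eq_zero_iff hab P₁ M u).1 h0))))
  obtain ⟨u, h1, -⟩ := exists_solution hab hu P₀ hℋ f 0
  obtain ⟨k, hkZ, hk⟩ := hβ (-bdryDefect hab ℋ P₁ M ⟨u, memH1_of_mem_maxGraph h1⟩)
  have h2 := (maxGraph a b P₁ P₀ ℋ).add_mem h1 hkZ
  rw [Prod.mk_add_mk] at h2
  have h3 := (bdryDefect_eq_zero_iff hab P₁ M (⟨u, memH1_of_mem_maxGraph h1⟩ + k)).1 (by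
    rw [map_add, hk, add_neg_cancel])
  refine ⟨_, _, h2, h3, ?_⟩
  rw [add_add_add_comm, add_sub_cancel, add_neg_cancel, add_zero]

end Range

/-! ### Boundary conditions given by contractions -/

section Boundary

variable {d : ℕ} {a b : ℝ} {ℋ : ℝ → Matrix (Fin d) (Fin d) ℝ} {P₁ P₀ : Matrix (Fin d) (Fin d) ℝ}

theorem mem_domW_iff {V₁ V₂ : Matrix (Fin d) (Fin d) ℝ} {u : L2 d a b} :
    u ∈ domW a b ℋ (Matrix.fromCols (V₁ * Qplus P₁ + V₂ * Qminus P₁)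
        (V₁ * Qminus P₁ + V₂ * Qplus P₁)) ↔
      MemH1 a b (mulH ℋ u) ∧ act V₁ (bdryOut P₁ ℋ u) + act V₂ (bdryIn P₁ ℋ u) = 0 :=
  and_congr_right fun _ => mulVec_eq_zero_iff V₁ V₂ (Qplus P₁) (Qminus P₁) _ _

theorem domW_eq_domM {V₁ V₂ : Matrix (Fin d) (Fin d) ℝ} (hV : IsUnit V₂) :
    domW a b ℋ (Matrix.fromCols (V₁ * Qplus P₁ + V₂ * Qminus P₁)
        (V₁ * Qminus P₁ + V₂ * Qplus P₁)) = domM a b P₁ ℋ (-(V₂⁻¹ * V₁)) := by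
  ext u
  rw [mem_domW_iff, act_add_act_eq_zero_iff hV]
  rfl

theorem fromCols_sub_eq (M : Matrix (Fin d) (Fin d) ℝ) :
    Matrix.fromCols (Qminus P₁ - M * Qplus P₁) (Qplus P₁ - M * Qminus P₁) =
      Matrix.fromCols (-M * Qplus P₁ + 1 * Qminus P₁) (-M * Qminus P₁ + 1 * Qplus P₁) := by
  congr 1 <;> rw [one_mul, neg_mul, sub_eq_neg_add]

theorem domM_eq_domW (M : Matrix (Fin d) (Fin d) ℝ) :
    domM a b P₁ ℋ M =
      domW a b ℋ (Matrix.fromCols (Qminus P₁ - M * Qplus P₁) (Qplus P₁ - M * Qminus P₁)) := by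
  rw [fromCols_sub_eq, domW_eq_domM isUnit_one]
  simp

theorem WCondition_of_norm_le (hP₁ : P₁.transpose = P₁) (hu : IsUnit P₁)
    {M : Matrix (Fin d) (Fin d) ℝ} (hM : ‖act M‖ ≤ 1) :
    WCondition P₁ (Matrix.fromCols (Qminus P₁ - M * Qplus P₁) (Qplus P₁ - M * Qminus P₁)) := by
  rw [fromCols_sub_eq, WCondition_iff hP₁ hu, posSemidef_sub_iff]
  intro x
  rw [Matrix.transpose_neg, act_neg, norm_neg, Matrix.transpose_one, act_one]
  exact norm_act_le ((norm_act_transpose M).trans_le hM) x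

/-- A matrix of full rank which satisfies the matrix inequality describes the boundary condition
of a contraction. -/
theorem exists_domW_eq_domM_of_rank (hP₁ : P₁.transpose = P₁) (hu : IsUnit P₁)
    {W : Matrix (Fin d) (Fin d ⊕ Fin d) ℝ} (hr : W.rank = d) (hW : WCondition P₁ W) :
    ∃ M : Matrix (Fin d) (Fin d) ℝ, ‖act M‖ ≤ 1 ∧ domW a b ℋ W = domM a b P₁ ℋ M := by
  obtain ⟨V₁, V₂, rfl⟩ := exists_eq_fromCols hP₁ hu W
  have h := (posSemidef_sub_iff V₁ V₂).1 ((WCondition_iff hP₁ hu V₁ V₂).1 hW)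
  have hV := isUnit_of_rank_eq hr h
  refine ⟨_, ?_, domW_eq_domM hV⟩
  rw [← norm_act_transpose]
  refine ContinuousLinearMap.opNorm_le_bound _ zero_le_one fun x => ?_
  rw [Matrix.transpose_neg, act_neg, norm_neg, Matrix.transpose_mul, act_mul, one_mul]
  refine (h _).trans_eq ?_
  rw [← act_mul, ← Matrix.transpose_mul,
    Matrix.nonsing_inv_mul _ ((Matrix.isUnit_iff_isUnit_det V₂).1 hV), Matrix.transpose_one, act_one]

/-- If the operator with domain `domW` is accretive, then `domW` is given by a contraction: the
energy identity forces `V₁ y + V₂ z = 0` to imply `‖z‖ ≤ ‖y‖`, so that `V₂` is one-to-one. -/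
theorem exists_domW_eq_domM_of_accretive (hab : a < b) (hP₁ : P₁.transpose = P₁) (hu : IsUnit P₁)
    (hℋ : IsDensity a b ℋ) {W : Matrix (Fin d) (Fin d ⊕ Fin d) ℝ}
    (hW : ∀ u ∈ domW a b ℋ W, ‖bdryIn P₁ ℋ u‖ ≤ ‖bdryOut P₁ ℋ u‖) :
    ∃ M : Matrix (Fin d) (Fin d) ℝ, ‖act M‖ ≤ 1 ∧ domW a b ℋ W = domM a b P₁ ℋ M := by
  obtain ⟨V₁, V₂, rfl⟩ := exists_eq_fromCols hP₁ hu W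
  have h : ∀ y z, act V₁ y + act V₂ z = 0 → ‖z‖ ≤ ‖y‖ := fun y z hyz => by
    obtain ⟨u, h1, rfl, rfl⟩ := exists_bdryOut_bdryIn hab hℋ hP₁ hu y z
    exact hW u (mem_domW_iff.2 ⟨h1, hyz⟩)
  have hV : IsUnit V₂ := isUnit_of_act_injective fun z hz => by
    have := h 0 z (by rw [map_zero, hz, add_zero])
    rwa [norm_zero, norm_le_zero_iff] at this
  refine ⟨_, ContinuousLinearMap.opNorm_le_bound _ zero_le_one fun y => ?_, domW_eq_domM hV⟩
  rw [one_mul]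
  exact h _ _ ((act_add_act_eq_zero_iff hV _ _).2 rfl)

/-- The matrix `W` is determined by `M` up to an invertible factor from the left. -/
theorem exists_eq_mul_of_domW_eq_domM (hab : a < b) (hP₁ : P₁.transpose = P₁) (hu : IsUnit P₁)
    (hℋ : IsDensity a b ℋ) {W : Matrix (Fin d) (Fin d ⊕ Fin d) ℝ} {M : Matrix (Fin d) (Fin d) ℝ}
    (h : domW a b ℋ W = domM a b P₁ ℋ M) :
    ∃ K : Matrix (Fin d) (Fin d) ℝ, IsUnit K ∧
      W = K * Matrix.fromCols (Qminus P₁ - M * Qplus P₁) (Qplus P₁ - M * Qminus P₁) := by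
  obtain ⟨V₁, V₂, rfl⟩ := exists_eq_fromCols hP₁ hu W
  have key : ∀ y z, act V₁ y + act V₂ z = 0 ↔ z = act M y := fun y z => by
    obtain ⟨u, h1, rfl, rfl⟩ := exists_bdryOut_bdryIn hab hℋ hP₁ hu y z
    have h2 := Set.ext_iff.1 h u
    rw [mem_domW_iff] at h2
    exact ⟨fun h3 => (h2.1 ⟨h1, h3⟩).2, fun h3 => (h2.2 ⟨h1, h3⟩).2⟩
  have hV : IsUnit V₂ := isUnit_of_act_injective fun z hz => by
    have := (key 0 z).1 (by rw [map_zero, hz, add_zero])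
    rwa [map_zero] at this
  have hV₁ : V₁ = -(V₂ * M) := act_injective (ContinuousLinearMap.ext fun y => by
    rw [act_neg, act_mul]
    exact eq_neg_of_add_eq_zero_left ((key y _).2 rfl))
  refine ⟨V₂, hV, ?_⟩
  rw [Matrix.mul_fromCols, hV₁]
  congr 1 <;> noncomm_ring

/-- The pairs `(y u, z u)` lie on the graph of a contraction: `y u ↦ z u` is well defined on the range
of `y`, and is extended by zero to the orthogonal complement of the range. -/
theorem exists_contraction {X : Type*} [AddCommGroup X] [Module ℝ X] (y z : X →ₗ[ℝ] Euc d)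
    (h : ∀ u, ‖z u‖ ≤ ‖y u‖) :
    ∃ M : Matrix (Fin d) (Fin d) ℝ, ‖act M‖ ≤ 1 ∧ ∀ u, z u = act M (y u) := by
  have hker : LinearMap.ker y ≤ LinearMap.ker z := fun u hu => by
    have := h u
    rwa [LinearMap.mem_ker.1 hu, norm_zero, norm_le_zero_iff] at this
  let Y := LinearMap.range y
  let M₀ : Y →ₗ[ℝ] Euc d := (LinearMap.ker y).liftQ z hker ∘ₗ y.quotKerEquivRange.symm
  have hM₀ : ∀ u, M₀ ⟨y u, u, rfl⟩ = z u := fun u => by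
    have : y.quotKerEquivRange.symm ⟨y u, u, rfl⟩ = (LinearMap.ker y).mkQ u := by
      rw [LinearEquiv.symm_apply_eq]
      rfl
    change (LinearMap.ker y).liftQ z hker (y.quotKerEquivRange.symm _) = _
    rw [this, Submodule.mkQ_apply, Submodule.liftQ_apply]
  have hM₀n : ∀ p : Y, ‖M₀ p‖ ≤ ‖p‖ := by
    rintro ⟨_, u, rfl⟩
    rw [hM₀]
    exact h u
  let M₁ : Euc d →L[ℝ] Euc d := LinearMap.toContinuousLinearMap M₀ ∘L Y.orthogonalProjectionOnto
  have hact : act ((Matrix.toEuclideanCLM (n := Fin d) (𝕜 := ℝ)).symm M₁) = M₁ := by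
    simp [act]
  refine ⟨(Matrix.toEuclideanCLM (n := Fin d) (𝕜 := ℝ)).symm M₁, ?_, fun u => ?_⟩
  · rw [hact]
    refine ContinuousLinearMap.opNorm_le_bound _ zero_le_one fun x => ?_
    refine (hM₀n _).trans ?_
    rw [one_mul]
    exact Y.norm_orthogonalProjectionOnto_apply_le x
  · rw [hact, ← hM₀]
    change _ = M₀ (Y.orthogonalProjectionOnto (y u))
    congr 1
    exact (Submodule.orthogonalProjectionOnto_mem_subspace_eq_self (⟨y u, u, rfl⟩ : Y)).symm

theorem sub_mem_domM (hab : a < b) {M : Matrix (Fin d) (Fin d) ℝ} {u v : L2 d a b}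
    (hu : u ∈ domM a b P₁ ℋ M) (hv : v ∈ domM a b P₁ ℋ M) : u - v ∈ domM a b P₁ ℋ M := by
  obtain ⟨x, rfl⟩ : ∃ x : maxDom d a b ℋ, (x : L2 d a b) = u := ⟨⟨u, hu.1⟩, rfl⟩
  obtain ⟨y, rfl⟩ : ∃ y : maxDom d a b ℋ, (y : L2 d a b) = v := ⟨⟨v, hv.1⟩, rfl⟩
  rw [← bdryDefect_eq_zero_iff hab] at hu hv
  rw [← Submodule.coe_sub, ← bdryDefect_eq_zero_iff hab, LinearMap.map_sub, hu, hv, sub_zero]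

/-- The operator `1 + 𝒜` with domain `domM` is one-to-one for a contraction `M`. -/
theorem eq_of_add_eq_add (hab : a < b) (hP₁ : P₁.transpose = P₁) (hu : IsUnit P₁)
    (hP₀ : P₀.transpose = -P₀) (hℋ : IsDensity a b ℋ) {M : Matrix (Fin d) (Fin d) ℝ}
    (hM : ‖act M‖ ≤ 1) {u w u' w' : L2 d a b} (h : (u, w) ∈ maxGraph a b P₁ P₀ ℋ)
    (hd : u ∈ domM a b P₁ ℋ M) (h' : (u', w') ∈ maxGraph a b P₁ P₀ ℋ)
    (hd' : u' ∈ domM a b P₁ ℋ M) (heq : u + w = u' + w') : u = u' := by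
  have hsub := (maxGraph a b P₁ P₀ ℋ).sub_mem h h'
  rw [Prod.mk_sub_mk] at hsub
  have hds := sub_mem_domM hab hd hd'
  have h0 : (u - u') + (w - w') = 0 :=
    (sub_add_sub_comm u u' w w').trans (sub_eq_zero_of_eq heq)
  have hn := innerH_nonneg_of_mem_domM hab hP₁ hu hP₀ hℋ hM hsub hds
  exact sub_eq_zero.1 (eq_zero_of_add_eq_zero hℋ hds.1 h0 hn)

theorem eq_of_mem_maxGraph {u w w' : L2 d a b} (h : (u, w) ∈ maxGraph a b P₁ P₀ ℋ)
    (h' : (u, w') ∈ maxGraph a b P₁ P₀ ℋ) : w = w' := by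
  have hsub := (maxGraph a b P₁ P₀ ℋ).sub_mem h h'
  rw [Prod.mk_sub_mk] at hsub
  exact sub_eq_zero.1 (maxGraph_singleValued a b P₁ P₀ ℋ _ hsub (sub_self u))

end Boundary

end PortHamiltonian

end

/-! ### The equivalences -/

open PortHamiltonian in
theorem theorem2p4 (d : ℕ) (a b : ℝ) (hab : a < b)
    (P₁ P₀ : Matrix (Fin d) (Fin d) ℝ) (hP₁ : P₁.transpose = P₁) (hP₁u : IsUnit P₁)
    (hP₀ : P₀.transpose = -P₀)
    (ℋ : ℝ → Matrix (Fin d) (Fin d) ℝ) (hℋ : IsDensity a b ℋ)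
    (D : Submodule ℝ (L2 d a b))
    (hD₀ : ∀ u : L2 d a b, MemH10 a b (mulH ℋ u) → u ∈ D)
    (hD₁ : ∀ u ∈ D, MemH1 a b (mulH ℋ u))
    (𝒜 : L2 d a b →ₗ.[ℝ] L2 d a b) (h𝒜 : 𝒜 = portHamiltonian a b P₁ P₀ ℋ D) :
    List.TFAE [
      IsMAccretive (innerH ℋ) 𝒜,
      IsAccretive (innerH ℋ) 𝒜 ∧
        ∃ W : Matrix (Fin d) (Fin d ⊕ Fin d) ℝ, (𝒜.domain : Set (L2 d a b)) = domW a b ℋ W,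
      ∃ W : Matrix (Fin d) (Fin d ⊕ Fin d) ℝ, W.rank = d ∧ WCondition P₁ W ∧
        (𝒜.domain : Set (L2 d a b)) = domW a b ℋ W,
      ∃ M : Matrix (Fin d) (Fin d) ℝ, ‖act M‖ ≤ 1 ∧
        (𝒜.domain : Set (L2 d a b)) = domM a b P₁ ℋ M] ∧
    (∀ M : Matrix (Fin d) (Fin d) ℝ, ‖act M‖ ≤ 1 →
      (𝒜.domain : Set (L2 d a b)) = domM a b P₁ ℋ M →
      (∀ u : 𝒜.domain, innerH ℋ (𝒜 u) (u : L2 d a b) =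
        1 / 2 * (‖bdryOut P₁ ℋ (u : L2 d a b)‖ ^ 2 -
          ‖act M (bdryOut P₁ ℋ (u : L2 d a b))‖ ^ 2)) ∧
      (∀ W : Matrix (Fin d) (Fin d ⊕ Fin d) ℝ,
        (IsAccretive (innerH ℋ) 𝒜 ∧ (𝒜.domain : Set (L2 d a b)) = domW a b ℋ W) ∨
          (W.rank = d ∧ WCondition P₁ W ∧ (𝒜.domain : Set (L2 d a b)) = domW a b ℋ W) →
        ∃ K : Matrix (Fin d) (Fin d) ℝ, IsUnit K ∧
          W = K * Matrix.fromCols (Qminus P₁ - M * Qplus P₁) (Qplus P₁ - M * Qminus P₁))) := by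
  have hgraph : ∀ u : 𝒜.domain, ((u : L2 d a b), 𝒜 u) ∈ maxGraph a b P₁ P₀ ℋ := by
    subst h𝒜
    exact portHamiltonian_apply a b P₁ P₀ ℋ D
  have hmem : ∀ u : 𝒜.domain, MemH1 a b (mulH ℋ (u : L2 d a b)) := fun u =>
    memH1_of_mem_maxGraph (hgraph u)
  have hacc : ∀ M : Matrix (Fin d) (Fin d) ℝ, ‖act M‖ ≤ 1 →
      (𝒜.domain : Set (L2 d a b)) = domM a b P₁ ℋ M → IsAccretive (innerH ℋ) 𝒜 :=
    fun M hM hdom u => innerH_nonneg_of_mem_domM hab hP₁ hP₁u hP₀ hℋ hM (hgraph u)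
      (hdom ▸ u.2)
  have hle : IsAccretive (innerH ℋ) 𝒜 → ∀ u : 𝒜.domain,
      ‖bdryIn P₁ ℋ (u : L2 d a b)‖ ≤ ‖bdryOut P₁ ℋ (u : L2 d a b)‖ := fun h u => by
    have h1 := h u
    rw [innerH_eq hab hP₁ hP₁u hP₀ hℋ (hgraph u)] at h1
    exact le_of_sq_le_sq (by linarith) (norm_nonneg _)
  refine ⟨?_, fun M hM hdom => ⟨fun u => ?_, fun W hW => ?_⟩⟩
  · tfae_have 1 → 4 := by
      rintro ⟨h1, h2⟩
      have hdom : 𝒜.domain ≤ maxDom d a b ℋ := fun u hu => hmem ⟨u, hu⟩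
      obtain ⟨M, hM, hMu⟩ := exists_contraction
        (bdryOutL hab ℋ P₁ ∘ₗ Submodule.inclusion hdom)
        (bdryInL hab ℋ P₁ ∘ₗ Submodule.inclusion hdom) (hle h1)
      refine ⟨M, hM, Subset.antisymm (fun u hu => ⟨hmem ⟨u, hu⟩, hMu ⟨u, hu⟩⟩) fun u hu => ?_⟩
      -- the operator with domain `domM` is an accretive extension of `𝒜`, and therefore equal to it
      obtain ⟨w, hw⟩ := exists_mem_maxGraph P₁ P₀ hu.1
      obtain ⟨u₀, hu₀⟩ := h2 (u + w)
      rw [eq_of_add_eq_add hab hP₁ hP₁u hP₀ hℋ hM hw hu (hgraph u₀) ⟨hmem u₀, hMu u₀⟩ hu₀.symm]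
      exact u₀.2
    tfae_have 4 → 1 := by
      rintro ⟨M, hM, hdom⟩
      refine ⟨hacc M hM hdom, fun f => ?_⟩
      obtain ⟨u, w, h1, h2, h3⟩ := exists_mem_domM hab hP₁ hP₁u hP₀ hℋ hM f
      rw [← hdom] at h2
      refine ⟨⟨u, h2⟩, ?_⟩
      rw [← eq_of_mem_maxGraph h1 (hgraph ⟨u, h2⟩)]
      exact h3
    tfae_have 4 → 3 := by
      rintro ⟨M, hM, hdom⟩
      exact ⟨_, rank_fromCols_eq hP₁ hP₁u M, WCondition_of_norm_le hP₁ hP₁u hM,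
        hdom.trans (domM_eq_domW M)⟩
    tfae_have 3 → 4 := by
      rintro ⟨W, hr, hW, hdom⟩
      obtain ⟨M, hM, h⟩ := exists_domW_eq_domM_of_rank hP₁ hP₁u hr hW
      exact ⟨M, hM, hdom.trans h⟩
    tfae_have 4 → 2 := by
      rintro ⟨M, hM, hdom⟩
      exact ⟨hacc M hM hdom, _, hdom.trans (domM_eq_domW M)⟩
    tfae_have 2 → 4 := by
      rintro ⟨h, W, hdom⟩
      obtain ⟨M, hM, h⟩ := exists_domW_eq_domM_of_accretive hab hP₁ hP₁u hℋ (W := W)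
        fun u hu => hle h ⟨u, (Set.ext_iff.1 hdom u).2 hu⟩
      exact ⟨M, hM, hdom.trans h⟩
    tfae_finish
  · have hu : (u : L2 d a b) ∈ domM a b P₁ ℋ M := hdom ▸ u.2
    rw [innerH_eq hab hP₁ hP₁u hP₀ hℋ (hgraph u), hu.2]
  · have hdomW : (𝒜.domain : Set (L2 d a b)) = domW a b ℋ W := hW.elim (·.2) (·.2.2)
    exact exists_eq_mul_of_domW_eq_domM hab hP₁ hP₁u hℋ (hdomW.symm.trans hdom)
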